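/- Model. Let $H$ be a probability distribution on $[0,\infty)$ with mean $1$ (fading law), let $\sigma$ be a probability distribution on a measurable space $S$ (law of the link state), and let $L(r)=L(s,r)\ge 0$, $s\in S$, $r\ge 0$, be a jointly measurable path loss function (a deterministic path loss is the case where $L$ does not depend on $s$). Assume that $L$ is physically feasible: there is a finite constant $L_0\ge 0$ with $L(s,0)=L_0$ and $L(s,r)\le L_0$ for all $s\in S$, $r\ge 0$, and $\gamma=\mathbb{E}\left[\int_0^\infty rL(r)\,dr\right]\in(0,\infty)$, where the expectation is over $s\sim\sigma$. For every $\lambda>0$ let base stations form a homogeneous Poisson point process on $\mathbb{R}^2$ with intensity $\lambda$, let $r_0$ be the distance from the origin to the closest (serving) station and $r_1,r_2,\dots$ the distances from the origin to the other stations, and give the stations i.i.d. marks $(h_i,s_i)\sim H\otimes\sigma$, independent of the positions. With noise power $N_0\ge 0$ put $$I_\lambda=\sum_{i\ge 1}h_iL(s_i,r_i),\qquad {\rm SINR}={\rm SINR}(\lambda)=\frac{h_0L(s_0,r_0)}{I_\lambda+N_0}.$$ Theorem 2. Suppose that at least one of the following holds. (a) There is $\lambda_c\ge 0$ such that $\mathbb{E}\left[I_{\lambda}^{-2}\right]<\infty$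 for all $\lambda\ge\lambda_c$, $\lambda>0$. (b) There are $\rho\ge 0$, $\zeta>0$, $\lambda_c\ge 0$ and a differentiable decreasing function $\tilde L:[\rho,\infty)\to[0,\infty)$ such that $\tilde L(r)\le L(s,r)$ for all $s\in S$, $r\ge\rho$; $r\tilde L(r)\ge\zeta\cdot(-\tilde L'(r))$ for all $r\ge\rho$; and $\int_{\rho}^\infty \frac{r}{\tilde L(r)^2}e^{-\pi\lambda r^2}\,dr<\infty$ for all $\lambda>\lambda_c$. Let $\theta_0\ge\epsilon>0$. Then the average constrained area spectral efficiency tends to zero: $$\lim_{\lambda\to\infty}\lambda\,\mathbb{E}\left[\log_2(1+{\rm SINR}(\lambda))\,\mathbf 1\{{\rm SINR}(\lambda)\ge\theta_0\}\right]=0.$$ -/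

import Mathlib

open MeasureTheory ProbabilityTheory Filter Set
open scoped ENNReal NNReal Topology

noncomputable section

namespace CellularNetwork

/-- The plane in which the base stations live; its canonical measure `volume` is Lebesgue
measure and its norm is the Euclidean one. -/
abbrev Plane : Type := EuclideanSpace ℝ (Fin 2)

/-! ### Poisson point processes -/

section Poisson

variable {Ω : Type*}

/-- The number of points of the random sequence `x` (with multiplicity) lying in `B`. -/
def pointCount (x : ℕ → Ω → Plane) (B : Set Plane) (ω : Ω) : ℝ≥0∞ :=
  ∑' i, B.indicator (fun _ => (1 : ℝ≥0∞)) (x i ω)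

/-- The random points `x 0, x 1, …` form a homogeneous Poisson point process of intensity `lam`
on the plane: the number of points in a Borel set `B` of finite area is Poisson distributed with
mean `lam * area B`, and the numbers of points in pairwise disjoint such sets are independent. -/
structure IsHomogeneousPPP [MeasurableSpace Ω] (P : Measure Ω) (lam : ℝ)
    (x : ℕ → Ω → Plane) : Prop where
  measurable : ∀ i, Measurable (x i)
  poisson : ∀ B : Set Plane, MeasurableSet B → volume B ≠ ∞ →
    HasLaw (pointCount x B)
      ((poissonMeasure (lam * (volume B).toReal).toNNReal).map (fun n : ℕ => (n : ℝ≥0∞))) P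
  indep : ∀ (n : ℕ) (B : Fin n → Set Plane), (∀ j, MeasurableSet (B j)) →
    (∀ j, volume (B j) ≠ ∞) → Pairwise (fun i j => Disjoint (B i) (B j)) →
    iIndepFun (fun j => pointCount x (B j)) P

end Poisson

/-! ### Fading and path loss -/

/-- A fading law: a probability distribution on `[0, ∞)` with mean one. -/
structure IsFadingLaw (H : Measure ℝ) : Prop where
  isProbabilityMeasure : IsProbabilityMeasure H
  nonneg : ∀ᵐ t ∂H, 0 ≤ t
  mean_one : ∫⁻ t, ENNReal.ofReal t ∂H = 1

section PathLoss

variable {S : Type*}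

/-- `γ = 𝔼 ∫₀^∞ r L(r) dr`, where `L s r` is the path loss at distance `r` of a link in state `s`,
and `σ` is the law of the link state. -/
def pathLossMoment [MeasurableSpace S] (σ : Measure S) (L : S → ℝ → ℝ) : ℝ≥0∞ :=
  ∫⁻ s, ∫⁻ r in Ioi (0 : ℝ), ENNReal.ofReal (r * L s r) ∂volume ∂σ

/-- Physically feasible path loss with value `L₀` at distance zero. The path loss may depend on a
random link state `s` (for instance line-of-sight or not) with law `σ`; a deterministic path loss
function is the case in which `L s` does not depend on `s`. -/
structure IsPhysicallyFeasible [MeasurableSpace S] (σ : Measure S) (L : S → ℝ → ℝ)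
    (L₀ : ℝ) : Prop where
  measurable : Measurable (Function.uncurry L)
  nonneg : ∀ s r, 0 ≤ r → 0 ≤ L s r
  at_zero : ∀ s, L s 0 = L₀
  le : ∀ s r, 0 ≤ r → L s r ≤ L₀
  moment_pos : 0 < pathLossMoment σ L
  moment_lt_top : pathLossMoment σ L < ∞

/-- The path loss is bounded below, beyond some distance `r₀`, by a differentiable decreasing
function `Lt : [r₀, ∞) → [0, ∞)` with `r Lt(r) / (-Lt'(r)) ≥ ζ` (written without division) and with
`∫_{r₀}^∞ r Lt(r)⁻² exp(-π lam r²) dr` finite for all sufficiently large `lam`. -/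
def HasTailMinorant (L : S → ℝ → ℝ) : Prop :=
  ∃ (r₀ ζ : ℝ) (Lt : ℝ → ℝ), 0 ≤ r₀ ∧ 0 < ζ ∧
    DifferentiableOn ℝ Lt (Ici r₀) ∧ AntitoneOn Lt (Ici r₀) ∧
    (∀ r, r₀ ≤ r → 0 ≤ Lt r) ∧
    (∀ s r, r₀ ≤ r → Lt r ≤ L s r) ∧
    (∀ r, r₀ ≤ r → ζ * (-derivWithin Lt (Ici r₀) r) ≤ r * Lt r) ∧
    ∃ lamc : ℝ, 0 ≤ lamc ∧ ∀ lam, lamc < lam →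
      ∫⁻ r in Ici r₀, ENNReal.ofReal r / ENNReal.ofReal (Lt r) ^ 2 *
        ENNReal.ofReal (Real.exp (-Real.pi * lam * r ^ 2)) < ∞

end PathLoss

/-! ### The network and its performance -/

/-- A random configuration of base stations: `x i` is the position, `h i` the small scale fading
and `s i` the link state (seen from the user at the origin) of station number `i`; station `0` is
the serving one. -/
structure Network (Ω S : Type*) where
  /-- positions -/
  x : ℕ → Ω → Plane
  /-- small scale fading -/
  h : ℕ → Ω → ℝ
  /-- link states -/
  s : ℕ → Ω → S

namespace Network

variable {Ω S : Type*}

/-- The network model with density `lam`, fading law `H` and link state law `σ`: the positions form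
a homogeneous Poisson point process of intensity `lam` in which station `0` is the closest to the
origin, and the pairs (fading, link state) of the stations are i.i.d. with law `H ⊗ σ` and
independent of the positions. -/
structure IsPoissonNetwork [MeasurableSpace Ω] [MeasurableSpace S] (P : Measure Ω) (H : Measure ℝ)
    (σ : Measure S) (lam : ℝ) (N : Network Ω S) : Prop where
  ppp : IsHomogeneousPPP P lam N.x
  nearest : ∀ᵐ ω ∂P, ∀ i, ‖N.x 0 ω‖ ≤ ‖N.x i ω‖
  measurable_fading : ∀ i, Measurable (N.h i)
  measurable_state : ∀ i, Measurable (N.s i)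
  law_marks : ∀ i, HasLaw (fun ω => (N.h i ω, N.s i ω)) (H.prod σ) P
  indep_marks : iIndepFun (fun i ω => (N.h i ω, N.s i ω)) P
  indep_positions : IndepFun (fun ω i => N.x i ω) (fun ω i => (N.h i ω, N.s i ω)) P

/-- Power received at the origin from station `i`. -/
def power (L : S → ℝ → ℝ) (N : Network Ω S) (i : ℕ) (ω : Ω) : ℝ≥0∞ :=
  ENNReal.ofReal (N.h i ω * L (N.s i ω) ‖N.x i ω‖)

/-- Aggregate interference: the power received from all stations but the serving one. In a Poisson
network these are almost surely the stations at a distance strictly larger than that of the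
serving one. -/
def interference (L : S → ℝ → ℝ) (N : Network Ω S) (ω : Ω) : ℝ≥0∞ :=
  ∑' i, N.power L (i + 1) ω

/-- Signal to interference plus noise ratio at the origin, with noise power `N₀`. -/
def sinr (L : S → ℝ → ℝ) (N₀ : ℝ) (N : Network Ω S) (ω : Ω) : ℝ≥0∞ :=
  N.power L 0 ω / (N.interference L ω + ENNReal.ofReal N₀)

end Network

/-- `log₂ (1 + y)` for `y ∈ [0, ∞]`. -/
def log2OnePlus (y : ℝ≥0∞) : ℝ≥0∞ :=
  if y = ∞ then ∞ else ENNReal.ofReal (Real.logb 2 (1 + y.toReal))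

variable {Ω S : Type*} [MeasurableSpace Ω]

/-- The average constrained area spectral efficiency
`lam * 𝔼[log₂ (1 + SINR) 1{SINR ≥ θ₀}]` (an expectation of a nonnegative variable, in `[0, ∞]`). -/
def constrainedASE (P : Measure Ω) (L : S → ℝ → ℝ) (N₀ lam θ₀ : ℝ) (N : Network Ω S) : ℝ≥0∞ :=
  ENNReal.ofReal lam *
    ∫⁻ ω, {ω | ENNReal.ofReal θ₀ ≤ N.sinr L N₀ ω}.indicator
      (fun ω => log2OnePlus (N.sinr L N₀ ω)) ω ∂P

/-- The interference of the networks `net lam` has a finite second negative moment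
`𝔼[1 / I²]` for every density `lam` from some `lamc ≥ 0` on. -/
def FiniteSecondNegativeMoment (P : Measure Ω) (L : S → ℝ → ℝ) (net : ℝ → Network Ω S) : Prop :=
  ∃ lamc : ℝ, 0 ≤ lamc ∧ ∀ lam, 0 < lam → lamc ≤ lam →
    ∫⁻ ω, ((net lam).interference L ω ^ 2)⁻¹ ∂P < ∞

end CellularNetwork

end

/-! Since `log₂ (1 + y) ≤ 2 y` and path loss is at most `L₀`, the constrained efficiency is at most
`2 𝔼[X Y; X Y ≥ v²]` with `X = h₀ L₀`, `Y = lam / I` and `v² = θ₀ lam`. The serving mark is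
independent of the interference `I`, hence so are `X` and `Y`. If `X Y ≥ v²` then `X ≥ v` or `Y ≥
v`, which gives the bound `𝔼[X; X ≥ v] 𝔼[Y] + 𝔼[X] 𝔼[Y; Y ≥ v]` (`lintegral_mul_indicator_le`). As
`X` is integrable, this tends to zero as soon as `𝔼[Y²] = lam² 𝔼[I⁻²]` stays bounded.

For that bound write `I⁻² = ∫₀^∞ t exp(-t I) dt` and split the plane into annuli of unit area around
the origin. Let `ψ_k(t)` (`farExponent`) be the Laplace exponent per unit density of the power from
outside the disk of area `k + 1`. Locating the nearest station in an annulus gives `lam exp(-lam)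
M(lam) ≤ 𝔼[I⁻²] ≤ M(lam)`, where `M(lam) = ∑ₖ exp(-lam k) ∫ t exp(-lam ψ_k(t)) dt` is
`negativeMomentSum`. Bernoulli's inequality gives `ψ_k(c t) ≤ c ψ_k(t)` for `c ≥ 1`, and rescaling
`t` then gives `lam² M(lam) ≤ lam₀² M(lam₀)` for `lam ≥ lam₀` (`negativeMomentSum_le`). It is
therefore enough that `M` is finite at a single density.

Under the moment condition this is the lower bound on `𝔼[I⁻²]`. Under the minorant condition, the
differential inequality lets the minorant decay at most like `exp(-r² / (2ζ))`, so `ψ_k` grows at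
least logarithmically in `t` (`le_farExponent`). For large `lam` the inner integral in `M` is then
of order `Lt⁻²` at the annulus radius, and the sum over annuli is compared with the integral in the
hypothesis. -/

noncomputable section

namespace CellularNetwork

/-! ### The exponential `e⁻ʸ` on `[0, ∞]` -/

/-- The function `y ↦ e⁻ʸ` on `[0, ∞]`. -/
def expNeg (y : ℝ≥0∞) : ℝ≥0∞ := EReal.exp (-(y : EReal))

lemma expNeg_zero : expNeg 0 = 1 := by simp [expNeg]

lemma expNeg_top : expNeg ∞ = 0 := by simp [expNeg]

lemma expNeg_le_one (y : ℝ≥0∞) : expNeg y ≤ 1 := by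
  simp [expNeg, EReal.exp_le_one_iff, EReal.neg_le_zero, EReal.coe_ennreal_nonneg]

lemma expNeg_ne_top (y : ℝ≥0∞) : expNeg y ≠ ∞ :=
  ((expNeg_le_one y).trans_lt ENNReal.one_lt_top).ne

lemma expNeg_antitone : Antitone expNeg := fun a b h => by
  simpa [expNeg] using h

lemma continuous_expNeg : Continuous expNeg :=
  ENNReal.continuous_exp.comp (continuous_neg.comp continuous_coe_ennreal_ereal)

lemma measurable_expNeg : Measurable expNeg := continuous_expNeg.measurable

lemma _root_.Measurable.expNeg {α : Type*} [MeasurableSpace α] {f : α → ℝ≥0∞}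
    (hf : Measurable f) : Measurable fun a => expNeg (f a) :=
  measurable_expNeg.comp hf

lemma expNeg_ofReal {r : ℝ} (hr : 0 ≤ r) :
    expNeg (ENNReal.ofReal r) = ENNReal.ofReal (Real.exp (-r)) := by
  simp only [expNeg, EReal.coe_ennreal_ofReal, max_eq_left hr, ← EReal.coe_neg, EReal.exp_coe]

lemma expNeg_add (a b : ℝ≥0∞) : expNeg (a + b) = expNeg a * expNeg b := by
  rw [expNeg, EReal.coe_ennreal_add, EReal.neg_add, sub_eq_add_neg, EReal.exp_add]
  · rfl
  · left; simp
  · right; simp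

lemma expNeg_sum {ι : Type*} (s : Finset ι) (f : ι → ℝ≥0∞) :
    expNeg (∑ i ∈ s, f i) = ∏ i ∈ s, expNeg (f i) := by
  classical
  induction s using Finset.induction_on with
  | empty => simp [expNeg_zero]
  | insert a s ha ih => rw [Finset.sum_insert ha, Finset.prod_insert ha, expNeg_add, ih]

lemma expNeg_mul_nat (a : ℝ≥0∞) (n : ℕ) : expNeg (a * n) = expNeg a ^ n := by
  induction n with
  | zero => simp [expNeg_zero]
  | succ n ih => rw [Nat.cast_succ, mul_add, mul_one, expNeg_add, ih, pow_succ]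

lemma tendsto_expNeg_sum_range (f : ℕ → ℝ≥0∞) :
    Tendsto (fun n => expNeg (∑ i ∈ Finset.range n, f i)) atTop (𝓝 (expNeg (∑' i, f i))) :=
  (continuous_expNeg.tendsto _).comp (ENNReal.tendsto_nat_tsum f)

lemma expNeg_eq_ofReal (a : ℝ≥0∞) : ∃ q : ℝ, 0 ≤ q ∧ q ≤ 1 ∧ expNeg a = ENNReal.ofReal q :=
  ⟨(expNeg a).toReal, ENNReal.toReal_nonneg,
    ENNReal.toReal_le_of_le_ofReal zero_le_one (by simpa using expNeg_le_one a),
    (ENNReal.ofReal_toReal (expNeg_ne_top a)).symm⟩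

/-- The Poisson probability generating function at `q = e⁻ᵃ`; `a = ∞` is allowed and corresponds to
`q = 0`. -/
lemma lintegral_expNeg_poisson (r : ℝ≥0) (a : ℝ≥0∞) :
    ∫⁻ n : ℕ, expNeg (a * n) ∂(poissonMeasure r) = expNeg (r * (1 - expNeg a)) := by
  obtain ⟨q, hq0, hq1, hq⟩ := expNeg_eq_ofReal a
  have hR : HasSum (fun n : ℕ => Real.exp (-r) * r ^ n / n.factorial * q ^ n)
      (Real.exp (-(r * (1 - q)))) := by
    have := (NormedSpace.expSeries_div_hasSum_exp (r * q : ℝ)).mul_left (Real.exp (-r))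
    rw [← Real.exp_eq_exp_ℝ, ← Real.exp_add] at this
    have h1 : -(r : ℝ) + r * q = -(r * (1 - q)) := by ring
    rw [h1] at this
    refine this.congr_fun fun n => ?_
    rw [mul_pow]; ring
  rw [lintegral_countable']
  simp_rw [expNeg_mul_nat, hq, poissonMeasure_singleton, ← ENNReal.ofReal_pow hq0]
  have h1 : (r : ℝ≥0∞) * (1 - ENNReal.ofReal q) = ENNReal.ofReal (r * (1 - q)) := by
    rw [ENNReal.ofReal_mul r.coe_nonneg, ENNReal.ofReal_sub _ hq0, ENNReal.ofReal_one,
      ENNReal.ofReal_coe_nnreal]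
  rw [h1, expNeg_ofReal (mul_nonneg r.coe_nonneg (by linarith)), ← hR.tsum_eq,
    ENNReal.ofReal_tsum_of_nonneg (fun n => by positivity) hR.summable]
  congr 1 with n
  rw [mul_comm, ENNReal.ofReal_mul (by positivity)]

/-! ### The Laplace functional of an unmarked Poisson process -/

section Laplace

variable {Ω : Type*} [MeasurableSpace Ω] {P : Measure Ω} {lam : ℝ} {x : ℕ → Ω → Plane}

namespace IsHomogeneousPPP

lemma measurable_pointCount (hx : IsHomogeneousPPP P lam x) {B : Set Plane}
    (hB : MeasurableSet B) : Measurable (pointCount x B) :=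
  Measurable.tsum fun i => (measurable_const.indicator hB).comp (hx.measurable i)

lemma lintegral_expNeg_pointCount (hx : IsHomogeneousPPP P lam x) (hlam : 0 ≤ lam) {B : Set Plane}
    (hB : MeasurableSet B) (hB' : volume B ≠ ∞) (a : ℝ≥0∞) :
    ∫⁻ ω, expNeg (a * pointCount x B ω) ∂P =
      expNeg (ENNReal.ofReal lam * ((1 - expNeg a) * volume B)) := by
  have hm : Measurable fun y : ℝ≥0∞ => expNeg (a * y) :=
    measurable_expNeg.comp (measurable_id.const_mul a)
  rw [(hx.poisson B hB hB').lintegral_comp hm.aemeasurable,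
    lintegral_map hm (measurable_of_countable _), lintegral_expNeg_poisson]
  congr 1
  have : ((lam * (volume B).toReal).toNNReal : ℝ≥0∞) = ENNReal.ofReal lam * volume B := by
    change ENNReal.ofReal _ = _
    rw [ENNReal.ofReal_mul hlam, ENNReal.ofReal_toReal hB']
  rw [this]; ring

lemma lintegral_mul_expNeg_sum (hx : IsHomogeneousPPP P lam x) (hlam : 0 ≤ lam) {n : ℕ}
    (B : Fin n → Set Plane) (hB : ∀ j, MeasurableSet (B j)) (hB' : ∀ j, volume (B j) ≠ ∞)
    (hd : Pairwise fun i j => Disjoint (B i) (B j)) {V : Set Plane} (hV : MeasurableSet V)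
    (hV' : volume V ≠ ∞) (hVB : ∀ j, Disjoint V (B j)) (a : Fin n → ℝ≥0∞)
    {g : ℝ≥0∞ → ℝ≥0∞} (hg : Measurable g) :
    ∫⁻ ω, g (pointCount x V ω) * expNeg (∑ j, a j * pointCount x (B j) ω) ∂P =
      (∫⁻ ω, g (pointCount x V ω) ∂P) *
        expNeg (ENNReal.ofReal lam * ∑ j, (1 - expNeg (a j)) * volume (B j)) := by
  -- `V` joins the cells as one more disjoint set, so a single use of independence covers both
  -- factors.
  set C : Fin (n + 1) → Set Plane := Fin.cons V B with hC
  set G : Fin (n + 1) → ℝ≥0∞ → ℝ≥0∞ :=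
    Fin.cons g fun j y => expNeg (a j * y) with hG
  have hGm : ∀ j, Measurable (G j) := by
    refine Fin.cases hg fun j => ?_
    exact measurable_expNeg.comp (measurable_id.const_mul (a j))
  have hCm : ∀ j, MeasurableSet (C j) := Fin.cases hV hB
  have hi : iIndepFun (fun j => pointCount x (C j)) P := by
    refine hx.indep (n + 1) C hCm (Fin.cases hV' hB') ?_
    intro i j
    refine Fin.cases ?_ (fun i => ?_) i <;> refine Fin.cases ?_ (fun j => ?_) j
    · intro h; exact absurd rfl h
    · intro _; exact hVB j
    · intro _; exact (hVB i).symm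
    · intro h; exact hd (fun h' => h (congrArg _ h'))
  have := lintegral_prod_eq_prod_lintegral_of_indepFun Finset.univ
    (fun j ω => G j (pointCount x (C j) ω)) (hi.comp G hGm)
    (fun j => (hGm j).comp (hx.measurable_pointCount (hCm j)))
  simp only [Fin.prod_univ_succ, hG, hC, Fin.cons_zero, Fin.cons_succ] at this
  simp_rw [expNeg_sum, Finset.mul_sum, expNeg_sum]
  rw [this]
  congr 1
  exact Finset.prod_congr rfl fun j _ => hx.lintegral_expNeg_pointCount hlam (hB j) (hB' j) _

lemma lintegral_mul_expNeg_simpleFunc (hx : IsHomogeneousPPP P lam x) (hlam : 0 ≤ lam)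
    (f : SimpleFunc Plane ℝ≥0∞) {V W : Set Plane} (hV : MeasurableSet V) (hV' : volume V ≠ ∞)
    (hW : MeasurableSet W) (hW' : volume W ≠ ∞) (hVW : Disjoint V W)
    {g : ℝ≥0∞ → ℝ≥0∞} (hg : Measurable g) :
    ∫⁻ ω, g (pointCount x V ω) * expNeg (∑' i, W.indicator f (x i ω)) ∂P =
      (∫⁻ ω, g (pointCount x V ω) ∂P) *
        expNeg (ENNReal.ofReal lam * ∫⁻ y, (1 - expNeg (W.indicator f y))) := by
  -- The cells are the level sets of `f` inside `W`, indexed by `Fin` to match the independence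
  -- axiom; the sum over points becomes a weighted sum of counts.
  set e := f.range.equivFin.symm with he
  set B : Fin f.range.card → Set Plane := fun j => f ⁻¹' {(e j : ℝ≥0∞)} ∩ W with hB
  have key := hx.lintegral_mul_expNeg_sum hlam B
    (fun j => (f.measurableSet_preimage _).inter hW)
    (fun j => measure_ne_top_of_subset inter_subset_right hW')
    (fun i j hij => by
      refine Disjoint.mono inter_subset_left inter_subset_left ?_
      refine Disjoint.preimage _ ?_
      simpa [Subtype.ext_iff] using fun h => hij (e.injective (Subtype.ext h)))
    hV hV' (fun j => hVW.mono_right inter_subset_right) (fun j => (e j : ℝ≥0∞)) hg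
  have h1 : ∀ ω, ∑ j, (e j : ℝ≥0∞) * pointCount x (B j) ω = ∑' i, W.indicator f (x i ω) := by
    intro ω
    simp only [pointCount, ← ENNReal.tsum_mul_left]
    rw [← Summable.tsum_finsetSum fun _ _ => ENNReal.summable]
    congr 1 with i
    rw [e.sum_comp (fun a : f.range => (a : ℝ≥0∞) * (f ⁻¹' {(a : ℝ≥0∞)} ∩ W).indicator
      (fun _ => (1 : ℝ≥0∞)) (x i ω)), Finset.univ_eq_attach, Finset.sum_attach f.range
      (fun a => a * (f ⁻¹' {a} ∩ W).indicator (fun _ => (1 : ℝ≥0∞)) (x i ω))]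
    rw [Finset.sum_eq_single (f (x i ω))]
    · by_cases h : x i ω ∈ W <;> simp [h]
    · intro b _ hb
      rw [indicator_of_notMem, mul_zero]
      exact fun h => hb h.1.symm
    · intro h; exact absurd (f.mem_range_self _) h
  have h2 : ∑ j, (1 - expNeg (e j)) * volume (B j) = ∫⁻ y, (1 - expNeg (W.indicator f y)) := by
    have h3 : (fun y => 1 - expNeg (W.indicator f y)) =
        W.indicator (f.map fun a => 1 - expNeg a) := by
      ext y
      by_cases h : y ∈ W <;> simp [h, expNeg_zero]
    rw [h3, lintegral_indicator hW, SimpleFunc.lintegral_eq_lintegral, SimpleFunc.map_lintegral,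
      e.sum_comp (fun a : f.range => (1 - expNeg a) * volume (f ⁻¹' {(a : ℝ≥0∞)} ∩ W)),
      Finset.univ_eq_attach, Finset.sum_attach f.range
      (fun a => (1 - expNeg a) * volume (f ⁻¹' {a} ∩ W))]
    refine Finset.sum_congr rfl fun a _ => ?_
    rw [Measure.restrict_apply (f.measurableSet_preimage _)]
  rw [← h2, ← key]
  simp_rw [h1]

/-- The Laplace functional of a homogeneous Poisson process, jointly with the number of points in
a set on which the test function vanishes. -/
theorem lintegral_mul_expNeg_tsum [IsProbabilityMeasure P] (hx : IsHomogeneousPPP P lam x)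
    (hlam : 0 ≤ lam) {f : Plane → ℝ≥0∞} (hf : Measurable f) {V : Set Plane}
    (hV : MeasurableSet V) (hV' : volume V ≠ ∞) (hfV : ∀ y ∈ V, f y = 0)
    {g : ℝ≥0∞ → ℝ≥0∞} (hg : Measurable g) (hg1 : ∀ y, g y ≤ 1) :
    ∫⁻ ω, g (pointCount x V ω) * expNeg (∑' i, f (x i ω)) ∂P =
      (∫⁻ ω, g (pointCount x V ω) ∂P) *
        expNeg (ENNReal.ofReal lam * ∫⁻ y, (1 - expNeg (f y))) := by
  -- Cutting down to balls keeps the areas finite, and removing `V` keeps the cells disjoint from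
  -- it; as `f` vanishes on `V`, the truncations still increase to `f`.
  set W : ℕ → Set Plane := fun n => Metric.ball 0 n \ V
  have hW : ∀ n, MeasurableSet (W n) := fun n => measurableSet_ball.diff hV
  have hW' : ∀ n, volume (W n) ≠ ∞ := fun n =>
    ((measure_mono sdiff_subset).trans_lt measure_ball_lt_top).ne
  set F : ℕ → Plane → ℝ≥0∞ := fun n => (W n).indicator (SimpleFunc.eapprox f n)
  have hFm : ∀ n, Measurable (F n) := fun n => (SimpleFunc.measurable _).indicator (hW n)
  have hmono : Monotone F := by
    intro m n hmn y
    have hsub : W m ⊆ W n := sdiff_subset_sdiff_left (Metric.ball_subset_ball (by exact_mod_cast hmn))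
    refine (indicator_le_indicator_of_subset hsub (fun _ => zero_le) y).trans ?_
    exact indicator_le_indicator (SimpleFunc.monotone_eapprox f hmn y)
  have hlim : ∀ y, Tendsto (fun n => F n y) atTop (𝓝 (f y)) := by
    intro y
    by_cases hy : y ∈ V
    · simp [F, W, hy, hfV]
    · refine (SimpleFunc.tendsto_eapprox hf y).congr' ?_
      obtain ⟨m, hm⟩ := exists_nat_gt ‖y‖
      filter_upwards [eventually_ge_atTop m] with n hn
      have : y ∈ W n := ⟨by
        rw [mem_ball_zero_iff]; exact hm.trans_le (by exact_mod_cast hn), hy⟩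
      simp [F, this]
  have hsum : ∀ ω, Tendsto (fun n => ∑' i, F n (x i ω)) atTop (𝓝 (∑' i, f (x i ω))) := by
    intro ω
    simp only [← lintegral_count]
    exact lintegral_tendsto_of_tendsto_of_monotone (fun n => measurable_of_countable _ |>.aemeasurable)
      (ae_of_all _ fun i m n hmn => hmono hmn _) (ae_of_all _ fun i => hlim _)
  have hN := hx.measurable_pointCount hV
  have hL : Tendsto (fun n => ∫⁻ ω, g (pointCount x V ω) * expNeg (∑' i, F n (x i ω)) ∂P) atTop
      (𝓝 (∫⁻ ω, g (pointCount x V ω) * expNeg (∑' i, f (x i ω)) ∂P)) := by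
    refine tendsto_lintegral_of_dominated_convergence (fun _ => 1) (fun n => ?_) (fun n => ?_)
      (by simp) ?_
    · exact (hg.comp hN).mul (measurable_expNeg.comp
        (Measurable.tsum fun i => (hFm n).comp (hx.measurable i)))
    · exact ae_of_all _ fun ω => mul_le_one' (hg1 _) (expNeg_le_one _)
    · refine ae_of_all _ fun ω => ENNReal.Tendsto.const_mul
        ((continuous_expNeg.tendsto _).comp (hsum ω)) (Or.inr ?_)
      exact ((hg1 _).trans_lt ENNReal.one_lt_top).ne
  have hR : Tendsto (fun n => (∫⁻ ω, g (pointCount x V ω) ∂P) *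
      expNeg (ENNReal.ofReal lam * ∫⁻ y, (1 - expNeg (F n y)))) atTop
      (𝓝 ((∫⁻ ω, g (pointCount x V ω) ∂P) *
        expNeg (ENNReal.ofReal lam * ∫⁻ y, (1 - expNeg (f y))))) := by
    refine ENNReal.Tendsto.const_mul ((continuous_expNeg.tendsto _).comp
      (ENNReal.Tendsto.const_mul ?_ (Or.inr ENNReal.ofReal_ne_top))) (Or.inr ?_)
    · refine lintegral_tendsto_of_tendsto_of_monotone
        (fun n => (measurable_const.sub (measurable_expNeg.comp (hFm n))).aemeasurable)
        (ae_of_all _ fun y m n hmn => tsub_le_tsub_left (expNeg_antitone (hmono hmn y)) _)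
        (ae_of_all _ fun y => ?_)
      exact ENNReal.Tendsto.sub tendsto_const_nhds ((continuous_expNeg.tendsto _).comp (hlim y))
        (Or.inl ENNReal.one_ne_top)
    · refine ((lintegral_mono fun ω => hg1 _).trans_lt ?_).ne
      simp
  refine tendsto_nhds_unique hL (hR.congr fun n => ?_)
  exact (hx.lintegral_mul_expNeg_simpleFunc hlam _ hV hV' (hW n) (hW' n) disjoint_sdiff_right
    hg).symm

end IsHomogeneousPPP

end Laplace


/-! ### Independent marks -/

/-- The function `q ↦ - log q` from `[0, 1]` to `[0, ∞]`. -/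
def negLog (q : ℝ≥0∞) : ℝ≥0∞ := (-(ENNReal.log q)).toENNReal

lemma expNeg_negLog {q : ℝ≥0∞} (hq : q ≤ 1) : expNeg (negLog q) = q := by
  have h : 0 ≤ -(ENNReal.log q) := by
    rw [EReal.le_neg, neg_zero, ← ENNReal.log_one]
    exact ENNReal.log_monotone hq
  rw [expNeg, negLog, EReal.coe_toENNReal h, neg_neg, ENNReal.exp_log]

lemma measurable_negLog : Measurable negLog :=
  (ENNReal.measurable_log.neg).ereal_toENNReal

section Marks

variable {M : Type*} [MeasurableSpace M] {μ : Measure M} [IsProbabilityMeasure μ]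

lemma lintegral_expNeg_le_one (f : M → ℝ≥0∞) : ∫⁻ a, expNeg (f a) ∂μ ≤ 1 :=
  (lintegral_mono fun a => expNeg_le_one (f a)).trans (by simp)

/-- Finite partial sums factor by independence of the coordinates, and dominated convergence passes
to the series. Using `negLog` turns the infinite product into a sum. -/
lemma lintegral_infinitePi_expNeg_tsum {f : ℕ → M → ℝ≥0∞} (hf : ∀ i, Measurable (f i)) :
    ∫⁻ m, expNeg (∑' i, f i (m i)) ∂(Measure.infinitePi fun _ : ℕ => μ) =
      expNeg (∑' i, negLog (∫⁻ a, expNeg (f i a) ∂μ)) := by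
  have hL : Tendsto (fun n => ∫⁻ m, expNeg (∑ i ∈ Finset.range n, f i (m i))
      ∂(Measure.infinitePi fun _ : ℕ => μ)) atTop
      (𝓝 (∫⁻ m, expNeg (∑' i, f i (m i)) ∂(Measure.infinitePi fun _ : ℕ => μ))) := by
    refine tendsto_lintegral_of_dominated_convergence (fun _ => 1) (fun n => ?_)
      (fun n => ae_of_all _ fun _ => expNeg_le_one _) (by simp)
      (ae_of_all _ fun _ => tendsto_expNeg_sum_range _)
    exact measurable_expNeg.comp
      (Finset.measurable_sum _ fun i _ => (hf i).comp (measurable_pi_apply i))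
  refine tendsto_nhds_unique hL ((tendsto_expNeg_sum_range _).congr fun n => ?_)
  have hi : iIndepFun (fun (i : ℕ) (m : ℕ → M) => expNeg (f i (m i)))
      (Measure.infinitePi fun _ : ℕ => μ) :=
    iIndepFun_infinitePi (X := fun i a => expNeg (f i a))
      (fun i => measurable_expNeg.comp (hf i))
  simp_rw [expNeg_sum]
  rw [lintegral_prod_eq_prod_lintegral_of_indepFun _ _ hi
    (fun i => measurable_expNeg.comp ((hf i).comp (measurable_pi_apply i)))]
  refine Finset.prod_congr rfl fun i _ => ?_
  rw [expNeg_negLog (lintegral_expNeg_le_one _)]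
  rw [← (measurePreserving_eval_infinitePi (fun _ : ℕ => μ) i).lintegral_comp
    (hf i).expNeg]

variable {Ω : Type*} [MeasurableSpace Ω] {P : Measure Ω} {lam : ℝ} {x : ℕ → Ω → Plane}
  {m : ℕ → Ω → M}

/-- The joint Laplace functional of an independently marked homogeneous Poisson process and of its
number of points in a set on which the test function vanishes. -/
theorem IsHomogeneousPPP.lintegral_mul_expNeg_tsum_marked [IsProbabilityMeasure P]
    (hx : IsHomogeneousPPP P lam x) (hlam : 0 ≤ lam) (hm : ∀ i, Measurable (m i))
    (hxm : P.map (fun ω => (fun i => x i ω, fun i => m i ω)) =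
      (P.map fun ω i => x i ω).prod (Measure.infinitePi fun _ : ℕ => μ))
    {G : Plane → M → ℝ≥0∞} (hG : Measurable (Function.uncurry G)) {V : Set Plane}
    (hV : MeasurableSet V) (hV' : volume V ≠ ∞) (hGV : ∀ y ∈ V, ∀ a, G y a = 0)
    {g : ℝ≥0∞ → ℝ≥0∞} (hg : Measurable g) (hg1 : ∀ y, g y ≤ 1) :
    ∫⁻ ω, g (pointCount x V ω) * expNeg (∑' i, G (x i ω) (m i ω)) ∂P =
      (∫⁻ ω, g (pointCount x V ω) ∂P) *
        expNeg (ENNReal.ofReal lam * ∫⁻ y, ∫⁻ a, (1 - expNeg (G y a)) ∂μ) := by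
  have hxm' : Measurable fun ω => (fun i => x i ω, fun i => m i ω) :=
    (measurable_pi_iff.2 hx.measurable).prodMk (measurable_pi_iff.2 hm)
  have hGy : ∀ y, Measurable (G y) := fun y => hG.comp measurable_prodMk_left
  -- Averaging over the marks with the positions frozen leaves the unmarked Laplace functional of
  -- this `f`.
  set f : Plane → ℝ≥0∞ := fun y => negLog (∫⁻ a, expNeg (G y a) ∂μ) with hf
  have hfm : Measurable f :=
    measurable_negLog.comp (Measurable.lintegral_prod_right' (measurable_expNeg.comp hG))
  have hfe : ∀ y, expNeg (f y) = ∫⁻ a, expNeg (G y a) ∂μ := fun y =>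
    expNeg_negLog (lintegral_expNeg_le_one _)
  have hN : Measurable fun ξ : ℕ → Plane => ∑' i, V.indicator (fun _ => (1 : ℝ≥0∞)) (ξ i) :=
    Measurable.tsum fun i => (measurable_const.indicator hV).comp (measurable_pi_apply i)
  have hΦ : Measurable fun p : (ℕ → Plane) × (ℕ → M) =>
      g (∑' i, V.indicator (fun _ => (1 : ℝ≥0∞)) (p.1 i)) *
        expNeg (∑' i, G (p.1 i) (p.2 i)) := by
    refine ((hg.comp hN).comp measurable_fst).mul (Measurable.tsum fun i => ?_).expNeg
    have hp : Measurable fun p : (ℕ → Plane) × (ℕ → M) => (p.1 i, p.2 i) := by fun_prop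
    exact hG.comp hp
  have hf0 : ∀ y ∈ V, f y = 0 := by
    intro y hy
    simp [hf, hGV y hy, expNeg_zero, negLog]
  have h1 : ∀ y, ∫⁻ a, (1 - expNeg (G y a)) ∂μ = 1 - expNeg (f y) := by
    intro y
    rw [lintegral_sub (hGy y).expNeg, hfe]
    · simp
    · exact ((lintegral_expNeg_le_one _).trans_lt ENNReal.one_lt_top).ne
    · exact ae_of_all _ fun a => expNeg_le_one _
  simp_rw [h1]
  rw [← hx.lintegral_mul_expNeg_tsum hlam hfm hV hV' hf0 hg hg1]
  calc _ = ∫⁻ p, g (∑' i, V.indicator (fun _ => (1 : ℝ≥0∞)) (p.1 i)) *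
        expNeg (∑' i, G (p.1 i) (p.2 i)) ∂(P.map fun ω => (fun i => x i ω, fun i => m i ω)) :=
        (lintegral_map hΦ hxm').symm
    _ = ∫⁻ ξ, g (∑' i, V.indicator (fun _ => (1 : ℝ≥0∞)) (ξ i)) * expNeg (∑' i, f (ξ i))
        ∂(P.map fun ω i => x i ω) := by
        rw [hxm]
        have : IsProbabilityMeasure (P.map fun ω i => x i ω) :=
          Measure.isProbabilityMeasure_map (measurable_pi_iff.2 hx.measurable).aemeasurable
        rw [lintegral_prod _ hΦ.aemeasurable]
        refine lintegral_congr fun ξ => ?_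
        dsimp only
        rw [lintegral_const_mul]
        · rw [lintegral_infinitePi_expNeg_tsum fun i => hGy (ξ i)]
        · exact (Measurable.tsum fun i => (hGy (ξ i)).comp (measurable_pi_apply i)).expNeg
    _ = _ := lintegral_map ((hg.comp hN).mul (measurable_expNeg.comp
        (Measurable.tsum fun i => hfm.comp (measurable_pi_apply i))))
        (measurable_pi_iff.2 hx.measurable)

end Marks


/-! ### Rings of unit area -/

/-- The open disk of area `k` around the origin. -/
def disk (k : ℕ) : Set Plane := {y | Real.pi * ‖y‖ ^ 2 < k}

/-- The annulus of area one between two consecutive disks. -/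
def ring (k : ℕ) : Set Plane := disk (k + 1) \ disk k

lemma mem_disk {k : ℕ} {y : Plane} : y ∈ disk k ↔ Real.pi * ‖y‖ ^ 2 < k := Iff.rfl

lemma measurableSet_disk (k : ℕ) : MeasurableSet (disk k) :=
  measurableSet_lt (by fun_prop) measurable_const

lemma measurableSet_ring (k : ℕ) : MeasurableSet (ring k) :=
  (measurableSet_disk _).diff (measurableSet_disk _)

lemma disk_mono : Monotone disk := fun _ _ h _ hy =>
  (mem_disk.1 hy).trans_le (Nat.cast_le.2 h)

lemma volume_setOf_norm_sq_lt (v : ℝ) :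
    volume {y : Plane | Real.pi * ‖y‖ ^ 2 < v} = ENNReal.ofReal v := by
  have h : {y : Plane | Real.pi * ‖y‖ ^ 2 < v} = Metric.ball 0 (√(v / Real.pi)) := by
    ext y
    rw [mem_ball_zero_iff, Real.lt_sqrt (norm_nonneg y), lt_div_iff₀' Real.pi_pos]
    rfl
  rw [h, EuclideanSpace.volume_ball_fin_two, ← ENNReal.ofReal_pow (Real.sqrt_nonneg _)]
  rcases le_total v 0 with hv | hv
  · rw [Real.sqrt_eq_zero_of_nonpos (div_nonpos_of_nonpos_of_nonneg hv Real.pi_pos.le),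
      ENNReal.ofReal_of_nonpos hv]
    simp
  · rw [Real.sq_sqrt (by positivity)]
    rw [← ENNReal.ofReal_mul (by positivity), div_mul_cancel₀ _ Real.pi_ne_zero]

lemma volume_disk (k : ℕ) : volume (disk k) = k := by
  rw [disk, volume_setOf_norm_sq_lt, ENNReal.ofReal_natCast]

lemma volume_ring (k : ℕ) : volume (ring k) = 1 := by
  rw [ring, measure_sdiff (disk_mono k.le_succ) (measurableSet_disk k).nullMeasurableSet
    (by simp [volume_disk]), volume_disk, volume_disk]
  push_cast
  exact ENNReal.add_sub_cancel_left (ENNReal.natCast_ne_top k)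

lemma exists_mem_ring (y : Plane) : ∃ k, y ∈ ring k := by
  refine ⟨⌊Real.pi * ‖y‖ ^ 2⌋₊, ?_, ?_⟩
  · rw [mem_disk]; push_cast; exact Nat.lt_floor_add_one _
  · rw [mem_disk, not_lt]; exact Nat.floor_le (by positivity)

/-! ### The Laplace transform of the interference -/

section Exponent

variable {S : Type*}

/-- The power received from a station at `y` with mark `a = (fading, link state)`. -/
def receivedPower (L : S → ℝ → ℝ) (y : Plane) (a : ℝ × S) : ℝ≥0∞ :=
  ENNReal.ofReal (a.1 * L a.2 ‖y‖)

open Classical in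
/-- The test function whose Laplace functional detects that `ring k` contains the nearest point. -/
def ringTest (L : S → ℝ → ℝ) (k : ℕ) (t : ℝ≥0∞) (y : Plane) (a : ℝ × S) : ℝ≥0∞ :=
  if y ∈ disk k then ∞ else if y ∈ disk (k + 1) then 0 else t * receivedPower L y a

lemma ringTest_of_mem_disk (L : S → ℝ → ℝ) {k : ℕ} (t : ℝ≥0∞) {y : Plane} (a : ℝ × S)
    (h : y ∈ disk k) : ringTest L k t y a = ∞ := if_pos h

lemma ringTest_of_mem_ring (L : S → ℝ → ℝ) {k : ℕ} (t : ℝ≥0∞) {y : Plane} (a : ℝ × S)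
    (h : y ∈ ring k) : ringTest L k t y a = 0 := by
  rw [ringTest, if_neg h.2, if_pos h.1]

lemma ringTest_of_notMem (L : S → ℝ → ℝ) {k : ℕ} (t : ℝ≥0∞) {y : Plane} (a : ℝ × S)
    (h : y ∉ disk (k + 1)) : ringTest L k t y a = t * receivedPower L y a := by
  rw [ringTest, if_neg (fun h' => h (disk_mono k.le_succ h')), if_neg h]

variable [MeasurableSpace S]

lemma measurable_receivedPower {L : S → ℝ → ℝ} (hL : Measurable (Function.uncurry L)) :
    Measurable (Function.uncurry (receivedPower L)) := by
  have h : Measurable fun p : Plane × (ℝ × S) => (p.2.2, ‖p.1‖) := by fun_prop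
  have h2 : Measurable fun p : Plane × (ℝ × S) => L p.2.2 ‖p.1‖ := hL.comp h
  have h3 : Measurable fun p : Plane × (ℝ × S) => p.2.1 := by fun_prop
  exact (h3.mul h2).ennreal_ofReal

/-- The Laplace exponent, per unit density, of the power received from outside `disk (k + 1)`. -/
def farExponent (μ : Measure (ℝ × S)) (L : S → ℝ → ℝ) (k : ℕ) (t : ℝ≥0∞) : ℝ≥0∞ :=
  ∫⁻ y in (disk (k + 1))ᶜ, ∫⁻ a, (1 - expNeg (t * receivedPower L y a)) ∂μ

lemma measurable_farExponent (μ : Measure (ℝ × S)) [SFinite μ] {L : S → ℝ → ℝ}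
    (hL : Measurable (Function.uncurry L)) (k : ℕ) : Measurable (farExponent μ L k) := by
  have h : Measurable fun p : (ℝ≥0∞ × Plane) × (ℝ × S) => receivedPower L p.1.2 p.2 := by
    have h1 : Measurable fun p : (ℝ≥0∞ × Plane) × (ℝ × S) => (p.1.2, p.2) := by fun_prop
    exact (measurable_receivedPower hL).comp h1
  have h2 : Measurable fun p : (ℝ≥0∞ × Plane) × (ℝ × S) =>
      1 - expNeg (p.1.1 * receivedPower L p.1.2 p.2) :=
    measurable_const.sub ((measurable_fst.comp measurable_fst).mul h).expNeg
  have h3 : Measurable fun p : ℝ≥0∞ × Plane =>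
      ∫⁻ a, (1 - expNeg (p.1 * receivedPower L p.2 a)) ∂μ := h2.lintegral_prod_right'
  exact h3.lintegral_prod_right'

lemma measurable_ringTest {L : S → ℝ → ℝ} (hL : Measurable (Function.uncurry L)) (k : ℕ)
    (t : ℝ≥0∞) : Measurable (Function.uncurry (ringTest L k t)) := by
  refine Measurable.ite ((measurableSet_disk k).preimage measurable_fst) measurable_const ?_
  exact Measurable.ite ((measurableSet_disk _).preimage measurable_fst) measurable_const
    ((measurable_receivedPower hL).const_mul t)

/-- The value `∞` on the disk contributes its area `k`, which encodes that the disk is empty; the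
annulus contributes nothing. -/
lemma lintegral_one_sub_expNeg_ringTest (μ : Measure (ℝ × S)) [IsProbabilityMeasure μ]
    (L : S → ℝ → ℝ) (k : ℕ) (t : ℝ≥0∞) :
    ∫⁻ y, ∫⁻ a, (1 - expNeg (ringTest L k t y a)) ∂μ = k + farExponent μ L k t := by
  rw [← lintegral_add_compl _ (measurableSet_disk (k + 1)), farExponent]
  congr 1
  · have : ∀ y ∈ disk (k + 1), ∫⁻ a, (1 - expNeg (ringTest L k t y a)) ∂μ =
        (disk k).indicator 1 y := by
      intro y hy
      by_cases h : y ∈ disk k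
      · simp [ringTest_of_mem_disk L t _ h, expNeg_top, h]
      · simp [ringTest_of_mem_ring L t _ ⟨hy, h⟩, expNeg_zero, h]
    rw [setLIntegral_congr_fun (measurableSet_disk _) this, lintegral_indicator_one
      (measurableSet_disk k), Measure.restrict_apply (measurableSet_disk k),
      inter_eq_left.2 (disk_mono k.le_succ), volume_disk]
  · refine setLIntegral_congr_fun (measurableSet_disk _).compl fun y hy => ?_
    simp only [ringTest_of_notMem L t _ hy]

end Exponent

section Interference

variable {Ω S : Type*}

lemma mul_interference (t : ℝ≥0∞) (N : Network Ω S) (L : S → ℝ → ℝ) (ω : Ω) :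
    t * N.interference L ω =
      ∑' i, t * receivedPower L (N.x (i + 1) ω) (N.h (i + 1) ω, N.s (i + 1) ω) := by
  rw [Network.interference, ← ENNReal.tsum_mul_left]; rfl

variable [MeasurableSpace Ω] [MeasurableSpace S] {P : Measure Ω} {H : Measure ℝ}
  {σ : Measure S} {lam : ℝ} {N : Network Ω S} {L : S → ℝ → ℝ}

namespace Network.IsPoissonNetwork

lemma measurable_mark (hN : N.IsPoissonNetwork P H σ lam) (i : ℕ) :
    Measurable fun ω => (N.h i ω, N.s i ω) :=
  (hN.measurable_fading i).prodMk (hN.measurable_state i)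

lemma measurable_power (hN : N.IsPoissonNetwork P H σ lam)
    (hL : Measurable (Function.uncurry L)) (i : ℕ) : Measurable (N.power L i) :=
  (measurable_receivedPower hL).comp ((hN.ppp.measurable i).prodMk (hN.measurable_mark i))

lemma measurable_interference (hN : N.IsPoissonNetwork P H σ lam)
    (hL : Measurable (Function.uncurry L)) : Measurable (N.interference L) :=
  Measurable.tsum fun i => hN.measurable_power hL (i + 1)

lemma measurable_tsum_ringTest (hN : N.IsPoissonNetwork P H σ lam)
    (hL : Measurable (Function.uncurry L)) (k : ℕ) (t : ℝ≥0∞) :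
    Measurable fun ω => ∑' i, ringTest L k t (N.x i ω) (N.h i ω, N.s i ω) := by
  have h : ∀ i, Measurable fun ω => ringTest L k t (N.x i ω) (N.h i ω, N.s i ω) := by
    intro i
    have hp : Measurable fun ω => (N.x i ω, (N.h i ω, N.s i ω)) :=
      (hN.ppp.measurable i).prodMk (hN.measurable_mark i)
    have hG := measurable_ringTest hL k t
    generalize ringTest L k t = G at hG ⊢
    exact hG.comp hp
  exact Measurable.tsum h

lemma lintegral_pointCount_ring_eq_one (hN : N.IsPoissonNetwork P H σ lam) (hlam : 0 ≤ lam)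
    (k : ℕ) : ∫⁻ ω, ({1} : Set ℝ≥0∞).indicator 1 (pointCount N.x (ring k) ω) ∂P =
      ENNReal.ofReal (lam * Real.exp (-lam)) := by
  have hm : Measurable (({1} : Set ℝ≥0∞).indicator (1 : ℝ≥0∞ → ℝ≥0∞)) :=
    measurable_one.indicator (measurableSet_singleton _)
  rw [(hN.ppp.poisson _ (measurableSet_ring k) (by simp [volume_ring])).lintegral_comp
    hm.aemeasurable, lintegral_map hm (measurable_of_countable _)]
  have h : (fun n : ℕ => ({1} : Set ℝ≥0∞).indicator (1 : ℝ≥0∞ → ℝ≥0∞) n) =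
      ({1} : Set ℕ).indicator 1 := by
    ext n
    by_cases hn : n = 1 <;> simp [hn]
  rw [h, lintegral_indicator_one (measurableSet_singleton _), poissonMeasure_singleton,
    volume_ring]
  simp [hlam, mul_comm]

lemma lintegral_fading [SFinite H] [IsProbabilityMeasure σ] (hN : N.IsPoissonNetwork P H σ lam)
    {φ : ℝ → ℝ≥0∞} (hφ : Measurable φ) : ∫⁻ ω, φ (N.h 0 ω) ∂P = ∫⁻ t, φ t ∂H := by
  have hm : Measurable fun a : ℝ × S => φ a.1 := hφ.comp measurable_fst
  rw [(hN.law_marks 0).lintegral_comp hm.aemeasurable, lintegral_prod _ hm.aemeasurable]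
  simp

variable [IsProbabilityMeasure P]

lemma map_positions_marks (hN : N.IsPoissonNetwork P H σ lam) :
    P.map (fun ω => (fun i => N.x i ω, fun i => (N.h i ω, N.s i ω))) =
      (P.map fun ω i => N.x i ω).prod (Measure.infinitePi fun _ : ℕ => H.prod σ) := by
  have h1 := (indepFun_iff_map_prod_eq_prod_map_map
    (measurable_pi_iff.2 hN.ppp.measurable).aemeasurable
    (measurable_pi_iff.2 hN.measurable_mark).aemeasurable).1 hN.indep_positions
  have h2 := hN.indep_marks.map_fun_eq_infinitePi_map hN.measurable_mark
  rw [h1, h2]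
  congr 2
  ext1 i
  exact (hN.law_marks i).map_eq

variable [IsProbabilityMeasure H] [IsProbabilityMeasure σ]

lemma lintegral_ringTest (hN : N.IsPoissonNetwork P H σ lam) (hlam : 0 ≤ lam)
    (hL : Measurable (Function.uncurry L)) (k : ℕ) (t : ℝ≥0∞) {g : ℝ≥0∞ → ℝ≥0∞}
    (hg : Measurable g) (hg1 : ∀ y, g y ≤ 1) :
    ∫⁻ ω, g (pointCount N.x (ring k) ω) *
        expNeg (∑' i, ringTest L k t (N.x i ω) (N.h i ω, N.s i ω)) ∂P =
      (∫⁻ ω, g (pointCount N.x (ring k) ω) ∂P) *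
        expNeg (ENNReal.ofReal lam * (k + farExponent (H.prod σ) L k t)) := by
  rw [← lintegral_one_sub_expNeg_ringTest]
  exact hN.ppp.lintegral_mul_expNeg_tsum_marked hlam hN.measurable_mark hN.map_positions_marks
    (measurable_ringTest hL k t) (measurableSet_ring k) (by simp [volume_ring])
    (fun y hy a => ringTest_of_mem_ring L t a hy) hg hg1

/-- If the nearest station is in annulus `k`, the disk inside is empty, and ignoring interferers in
that annulus only increases the exponential. The bound sums over all `k`, which avoids conditioning
on the nearest distance. -/
lemma lintegral_expNeg_interference_le (hN : N.IsPoissonNetwork P H σ lam) (hlam : 0 ≤ lam)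
    (hL : Measurable (Function.uncurry L)) (t : ℝ≥0∞) :
    ∫⁻ ω, expNeg (t * N.interference L ω) ∂P ≤
      ∑' k : ℕ, expNeg (ENNReal.ofReal lam * (k + farExponent (H.prod σ) L k t)) := by
  have h1 : ∀ k : ℕ, expNeg (ENNReal.ofReal lam * (k + farExponent (H.prod σ) L k t)) =
      ∫⁻ ω, expNeg (∑' i, ringTest L k t (N.x i ω) (N.h i ω, N.s i ω)) ∂P := by
    intro k
    simpa using (hN.lintegral_ringTest hlam hL k t (g := fun _ => 1) measurable_const
      (fun _ => le_rfl)).symm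
  simp_rw [h1]
  rw [← lintegral_tsum fun k => (hN.measurable_tsum_ringTest hL k t).expNeg.aemeasurable]
  refine lintegral_mono_ae ?_
  filter_upwards [hN.nearest] with ω hω
  obtain ⟨k, hk⟩ := exists_mem_ring (N.x 0 ω)
  refine le_trans (expNeg_antitone ?_) (ENNReal.le_tsum k)
  rw [tsum_eq_zero_add' ENNReal.summable, ringTest_of_mem_ring L t _ hk, zero_add,
    mul_interference]
  refine ENNReal.tsum_le_tsum fun i => ?_
  by_cases h : N.x (i + 1) ω ∈ disk (k + 1)
  · have h' : N.x (i + 1) ω ∉ disk k := by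
      intro h2
      refine hk.2 (mem_disk.2 (lt_of_le_of_lt ?_ (mem_disk.1 h2)))
      have := hω (i + 1)
      gcongr
    rw [ringTest_of_mem_ring L t _ ⟨h, h'⟩]
    exact zero_le
  · rw [ringTest_of_notMem L t _ h]

/-- Restricting to the event that the annulus of the nearest station holds no other point makes the
bound exact there; `lam exp(-lam)` is the probability of exactly one point in unit area. -/
lemma le_lintegral_expNeg_interference (hN : N.IsPoissonNetwork P H σ lam) (hlam : 0 ≤ lam)
    (hL : Measurable (Function.uncurry L)) (t : ℝ≥0∞) :
    ENNReal.ofReal (lam * Real.exp (-lam)) *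
        ∑' k : ℕ, expNeg (ENNReal.ofReal lam * (k + farExponent (H.prod σ) L k t)) ≤
      ∫⁻ ω, expNeg (t * N.interference L ω) ∂P := by
  have hm : Measurable (({1} : Set ℝ≥0∞).indicator (1 : ℝ≥0∞ → ℝ≥0∞)) :=
    measurable_one.indicator (measurableSet_singleton _)
  have h1 : ∀ k : ℕ, ENNReal.ofReal (lam * Real.exp (-lam)) *
      expNeg (ENNReal.ofReal lam * (k + farExponent (H.prod σ) L k t)) =
      ∫⁻ ω, ({1} : Set ℝ≥0∞).indicator 1 (pointCount N.x (ring k) ω) *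
        expNeg (∑' i, ringTest L k t (N.x i ω) (N.h i ω, N.s i ω)) ∂P := by
    intro k
    rw [hN.lintegral_ringTest hlam hL k t hm
      (fun _ => indicator_le_self' (fun _ _ => zero_le) _),
      hN.lintegral_pointCount_ring_eq_one hlam]
  rw [← ENNReal.tsum_mul_left]
  simp_rw [h1]
  have hmeas : ∀ k, Measurable fun ω => ({1} : Set ℝ≥0∞).indicator 1 (pointCount N.x (ring k) ω) *
      expNeg (∑' i, ringTest L k t (N.x i ω) (N.h i ω, N.s i ω)) := fun k =>
    (hm.comp (hN.ppp.measurable_pointCount (measurableSet_ring k))).mul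
      (hN.measurable_tsum_ringTest hL k t).expNeg
  rw [← lintegral_tsum fun k => (hmeas k).aemeasurable]
  refine lintegral_mono_ae ?_
  filter_upwards [hN.nearest] with ω hω
  obtain ⟨k, hk⟩ := exists_mem_ring (N.x 0 ω)
  have hout : ∀ i, N.x i ω ∉ disk k := by
    intro i h2
    refine hk.2 (mem_disk.2 (lt_of_le_of_lt ?_ (mem_disk.1 h2)))
    have := hω i
    gcongr
  -- Only the annulus of the nearest station contributes: smaller annuli are empty, so the indicator
  -- vanishes, and for larger ones station `0` lies in the forbidden disk.
  rw [tsum_eq_single k]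
  · by_cases h1 : pointCount N.x (ring k) ω = 1
    · rw [indicator_of_mem (by simpa using h1), Pi.one_apply, one_mul]
      refine expNeg_antitone ?_
      have hne : ∀ i, N.x (i + 1) ω ∉ ring k := by
        rw [pointCount, tsum_eq_zero_add' ENNReal.summable, indicator_of_mem hk] at h1
        have h2 := (ENNReal.add_right_inj ENNReal.one_ne_top).1 (h1.trans (add_zero 1).symm)
        intro i hi
        have := ENNReal.tsum_eq_zero.1 h2 i
        rw [indicator_of_mem hi] at this
        exact one_ne_zero this
      rw [tsum_eq_zero_add' ENNReal.summable, ringTest_of_mem_ring L t _ hk, zero_add,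
        mul_interference]
      refine ENNReal.tsum_le_tsum fun i => ?_
      rw [ringTest_of_notMem L t _ fun h => hne i ⟨h, hout _⟩]
    · rw [indicator_of_notMem (by simpa using h1), zero_mul]
      exact zero_le
  · intro j hj
    rcases lt_or_gt_of_ne hj with h | h
    · have : pointCount N.x (ring j) ω = 0 := by
        refine ENNReal.tsum_eq_zero.2 fun i => indicator_of_notMem (fun hi => ?_) _
        exact hout i (disk_mono (Nat.succ_le_of_lt h) hi.1)
      rw [this, indicator_of_notMem (by simp), zero_mul]
    · have h0 : N.x 0 ω ∈ disk j := disk_mono (Nat.succ_le_of_lt h) hk.1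
      have : ∑' i, ringTest L j t (N.x i ω) (N.h i ω, N.s i ω) = ∞ := by
        rw [tsum_eq_zero_add' ENNReal.summable, ringTest_of_mem_disk L t _ h0, top_add]
      rw [this, expNeg_top, mul_zero]

end Network.IsPoissonNetwork

end Interference


/-! ### The second negative moment of the interference -/

lemma lintegral_Ioi_comp_mul_left {c : ℝ} (hc : 0 < c) (G : ℝ → ℝ≥0∞) :
    ∫⁻ t in Ioi (0 : ℝ), G (c * t) = ENNReal.ofReal c⁻¹ * ∫⁻ s in Ioi (0 : ℝ), G s := by
  have himg : (fun t => c * t) '' Ioi (0 : ℝ) = Ioi 0 := by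
    rw [image_mul_left_Ioi hc, mul_zero]
  have h := lintegral_image_eq_lintegral_abs_deriv_mul (measurableSet_Ioi (a := (0 : ℝ)))
    (f := fun t => c * t) (f' := fun _ => c)
    (fun t _ => by simpa using ((hasDerivAt_id t).const_mul c).hasDerivWithinAt)
    (mul_right_injective₀ hc.ne').injOn G
  rw [himg, lintegral_const_mul' _ _ ENNReal.ofReal_ne_top, abs_of_pos hc] at h
  rw [h, ← mul_assoc, ← ENNReal.ofReal_mul (by positivity), inv_mul_cancel₀ hc.ne',
    ENNReal.ofReal_one, one_mul]

lemma lintegral_mul_expNeg_of_pos {r : ℝ} (hr : 0 < r) :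
    ∫⁻ t in Ioi (0 : ℝ), ENNReal.ofReal t * expNeg (ENNReal.ofReal t * ENNReal.ofReal r) =
      (ENNReal.ofReal r ^ 2)⁻¹ := by
  have h := Real.integral_rpow_mul_exp_neg_mul_Ioi (a := 2) (r := r) two_pos hr
  have h2 : ∫ t in Ioi (0 : ℝ), t * Real.exp (-(r * t)) = (r ^ 2)⁻¹ := by
    rw [Real.Gamma_two, mul_one] at h
    norm_num at h
    exact h
  -- A non-integrable function has integral `0` by convention, so the nonzero value already forces
  -- integrability.
  have hint : IntegrableOn (fun t => t * Real.exp (-(r * t))) (Ioi 0) := by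
    by_contra hc
    rw [integral_undef hc] at h2
    have : 0 < (r ^ 2)⁻¹ := by positivity
    exact this.ne h2
  rw [← ENNReal.ofReal_pow hr.le, ← ENNReal.ofReal_inv_of_pos (by positivity), ← h2,
    ofReal_integral_eq_lintegral_ofReal hint]
  · refine setLIntegral_congr_fun measurableSet_Ioi fun t ht => ?_
    have ht' : (0 : ℝ) ≤ t := le_of_lt ht
    rw [← ENNReal.ofReal_mul ht', expNeg_ofReal (by positivity), ← ENNReal.ofReal_mul ht',
      mul_comm t r]
  · filter_upwards [ae_restrict_mem measurableSet_Ioi] with t ht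
    have ht' : (0 : ℝ) ≤ t := le_of_lt ht
    simp only [Pi.zero_apply]
    positivity

lemma lintegral_mul_expNeg (y : ℝ≥0∞) :
    ∫⁻ t in Ioi (0 : ℝ), ENNReal.ofReal t * expNeg (ENNReal.ofReal t * y) = (y ^ 2)⁻¹ := by
  rcases eq_or_ne y ∞ with rfl | hy
  · have : ∀ t ∈ Ioi (0 : ℝ), ENNReal.ofReal t * expNeg (ENNReal.ofReal t * ∞) = 0 := by
      intro t ht
      rw [ENNReal.mul_top (by simpa using ht), expNeg_top, mul_zero]
    rw [setLIntegral_congr_fun measurableSet_Ioi this]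
    simp
  rcases eq_or_ne y 0 with rfl | h0
  -- At `y = 0` the integral dominates its value at `y = 1 / (n + 1)` for every `n`, hence is
  -- infinite.
  · have hle : ∀ n : ℕ, ((n : ℝ≥0∞) + 1) ^ 2 ≤
        ∫⁻ t in Ioi (0 : ℝ), ENNReal.ofReal t * expNeg (ENNReal.ofReal t * 0) := by
      intro n
      have hn : (0 : ℝ) < ((n : ℝ) + 1)⁻¹ := by positivity
      have he : ((n : ℝ≥0∞) + 1) ^ 2 = (ENNReal.ofReal ((n : ℝ) + 1)⁻¹ ^ 2)⁻¹ := by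
        rw [ENNReal.ofReal_inv_of_pos (by positivity), ← ENNReal.inv_pow, inv_inv,
          ENNReal.ofReal_add (by positivity) zero_le_one]
        simp
      rw [he, ← lintegral_mul_expNeg_of_pos hn]
      refine lintegral_mono fun t => mul_le_mul_right (expNeg_antitone ?_) _
      simp
    have : ∫⁻ t in Ioi (0 : ℝ), ENNReal.ofReal t * expNeg (ENNReal.ofReal t * 0) = ∞ := by
      refine ENNReal.eq_top_of_forall_nnreal_le fun r => ?_
      obtain ⟨n, hn⟩ := exists_nat_gt r
      refine le_trans ?_ (hle n)
      have h1 : (r : ℝ≥0∞) ≤ (n : ℝ≥0∞) + 1 :=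
        (show (r : ℝ≥0∞) ≤ (n : ℝ≥0∞) by exact_mod_cast hn.le).trans le_self_add
      exact h1.trans (le_self_pow₀ le_add_self two_ne_zero)
    rw [this]; simp
  · have := lintegral_mul_expNeg_of_pos (ENNReal.toReal_pos h0 hy)
    rwa [ENNReal.ofReal_toReal hy] at this

section Bound

variable {S : Type*} [MeasurableSpace S]

/-- Up to factors depending on the density only, the second negative moment of the interference in
a Poisson network of density `lam`. -/
def negativeMomentSum (μ : Measure (ℝ × S)) (L : S → ℝ → ℝ) (lam : ℝ) : ℝ≥0∞ :=
  ∑' k : ℕ, expNeg (ENNReal.ofReal lam * k) * ∫⁻ t in Ioi (0 : ℝ),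
    ENNReal.ofReal t * expNeg (ENNReal.ofReal lam * farExponent μ L k (ENNReal.ofReal t))

lemma negativeMomentSum_eq (μ : Measure (ℝ × S)) [SFinite μ] {L : S → ℝ → ℝ}
    (hL : Measurable (Function.uncurry L)) (lam : ℝ) :
    negativeMomentSum μ L lam = ∫⁻ t in Ioi (0 : ℝ), ENNReal.ofReal t *
      ∑' k : ℕ, expNeg (ENNReal.ofReal lam * (k + farExponent μ L k (ENNReal.ofReal t))) := by
  have hm : ∀ k, Measurable fun t : ℝ => ENNReal.ofReal t *
      expNeg (ENNReal.ofReal lam * farExponent μ L k (ENNReal.ofReal t)) := fun k =>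
    ENNReal.measurable_ofReal.mul
      (((measurable_farExponent μ hL k).comp ENNReal.measurable_ofReal).const_mul _).expNeg
  simp_rw [negativeMomentSum, ← ENNReal.tsum_mul_left]
  rw [lintegral_tsum]
  · congr 1 with k
    rw [← lintegral_const_mul _ (hm k)]
    refine lintegral_congr fun t => ?_
    rw [mul_add, expNeg_add, mul_left_comm]
  · intro k
    exact (ENNReal.measurable_ofReal.mul
      ((((measurable_farExponent μ hL k).comp ENNReal.measurable_ofReal).const_add
        _).const_mul _).expNeg).aemeasurable

/-- Bernoulli's inequality for `(e⁻ʸ)ᶜ`, with `y = ∞` treated apart. -/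
lemma one_sub_expNeg_mul_le {c : ℝ} (hc : 1 ≤ c) (y : ℝ≥0∞) :
    1 - expNeg (ENNReal.ofReal c * y) ≤ ENNReal.ofReal c * (1 - expNeg y) := by
  have hc0 : 0 < c := one_pos.trans_le hc
  rcases eq_or_ne y ∞ with rfl | hy
  · rw [ENNReal.mul_top (by simpa using hc0), expNeg_top, tsub_zero, mul_one]
    simpa using hc
  · obtain ⟨r, hr, rfl⟩ : ∃ r : ℝ, 0 ≤ r ∧ y = ENNReal.ofReal r :=
      ⟨y.toReal, ENNReal.toReal_nonneg, (ENNReal.ofReal_toReal hy).symm⟩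
    rw [← ENNReal.ofReal_mul hc0.le, expNeg_ofReal hr, expNeg_ofReal (by positivity),
      ← ENNReal.ofReal_one, ← ENNReal.ofReal_sub _ (Real.exp_nonneg _),
      ← ENNReal.ofReal_sub _ (Real.exp_nonneg _), ← ENNReal.ofReal_mul hc0.le]
    refine ENNReal.ofReal_le_ofReal ?_
    have := one_add_mul_self_le_rpow_one_add (s := Real.exp (-r) - 1)
      (by linarith [Real.exp_pos (-r)]) hc
    rw [add_sub_cancel, ← Real.exp_mul, neg_mul, mul_comm r] at this
    linarith

lemma farExponent_mul_le (μ : Measure (ℝ × S)) (L : S → ℝ → ℝ) (k : ℕ) {c : ℝ} (hc : 1 ≤ c)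
    (t : ℝ≥0∞) :
    farExponent μ L k (ENNReal.ofReal c * t) ≤ ENNReal.ofReal c * farExponent μ L k t := by
  rw [farExponent, farExponent, ← lintegral_const_mul' _ _ ENNReal.ofReal_ne_top]
  refine lintegral_mono fun y => ?_
  rw [← lintegral_const_mul' _ _ ENNReal.ofReal_ne_top]
  refine lintegral_mono fun a => ?_
  rw [mul_assoc]
  exact one_sub_expNeg_mul_le hc _

/-- With `c = lam / lam₀`, `lam ψ_k(t) = lam₀ c ψ_k(t) ≥ lam₀ ψ_k(c t)`; substituting `s = c t` in
`t dt` yields the factor `c⁻²`. -/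
lemma negativeMomentSum_le (μ : Measure (ℝ × S)) (L : S → ℝ → ℝ) {lam₀ lam : ℝ} (h0 : 0 < lam₀)
    (h : lam₀ ≤ lam) :
    negativeMomentSum μ L lam ≤
      ENNReal.ofReal ((lam₀ / lam) ^ 2) * negativeMomentSum μ L lam₀ := by
  have hlam : 0 < lam := h0.trans_le h
  set c := lam / lam₀ with hc
  have hc1 : 1 ≤ c := (one_le_div h0).2 h
  have hc0 : 0 < c := one_pos.trans_le hc1
  have hlc : ENNReal.ofReal lam = ENNReal.ofReal lam₀ * ENNReal.ofReal c := by
    rw [← ENNReal.ofReal_mul h0.le, hc, mul_div_cancel₀ _ h0.ne']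
  rw [negativeMomentSum, negativeMomentSum, ← ENNReal.tsum_mul_left]
  refine ENNReal.tsum_le_tsum fun k => ?_
  rw [mul_left_comm]
  refine mul_le_mul' (expNeg_antitone (mul_le_mul_left (ENNReal.ofReal_le_ofReal h) _)) ?_
  set G : ℝ → ℝ≥0∞ := fun s => ENNReal.ofReal s *
    expNeg (ENNReal.ofReal lam₀ * farExponent μ L k (ENNReal.ofReal s)) with hG
  calc _ ≤ ∫⁻ t in Ioi (0 : ℝ), ENNReal.ofReal c⁻¹ * G (c * t) := by
        refine setLIntegral_mono' measurableSet_Ioi fun t ht => ?_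
        have ht' : (0 : ℝ) ≤ t := le_of_lt ht
        rw [hG]
        simp only
        rw [← mul_assoc, ← ENNReal.ofReal_mul (by positivity), inv_mul_cancel_left₀ hc0.ne']
        refine mul_le_mul_right (expNeg_antitone ?_) _
        rw [hlc, mul_assoc, ENNReal.ofReal_mul hc0.le]
        exact mul_le_mul_right (farExponent_mul_le μ L k hc1 _) _
    _ = ENNReal.ofReal ((lam₀ / lam) ^ 2) * ∫⁻ s in Ioi (0 : ℝ), G s := by
        rw [lintegral_const_mul' _ _ ENNReal.ofReal_ne_top, lintegral_Ioi_comp_mul_left hc0,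
          ← mul_assoc, ← ENNReal.ofReal_mul (by positivity), hc, inv_div, sq]

end Bound

namespace Network.IsPoissonNetwork

variable {Ω S : Type*} [MeasurableSpace Ω] [MeasurableSpace S] {P : Measure Ω} {H : Measure ℝ}
  {σ : Measure S} {lam : ℝ} {N : Network Ω S} {L : S → ℝ → ℝ} [IsProbabilityMeasure P]

/-- Tonelli, applied to `I⁻² = ∫ t exp(-t I) dt`. -/
lemma lintegral_inv_sq_interference (hN : N.IsPoissonNetwork P H σ lam)
    (hL : Measurable (Function.uncurry L)) :
    ∫⁻ ω, (N.interference L ω ^ 2)⁻¹ ∂P = ∫⁻ t in Ioi (0 : ℝ), ENNReal.ofReal t *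
      ∫⁻ ω, expNeg (ENNReal.ofReal t * N.interference L ω) ∂P := by
  have hI := hN.measurable_interference hL
  have hm : Measurable fun p : Ω × ℝ => expNeg (ENNReal.ofReal p.2 * N.interference L p.1) :=
    ((ENNReal.measurable_ofReal.comp measurable_snd).mul (hI.comp measurable_fst)).expNeg
  have hm2 : Measurable fun p : Ω × ℝ => ENNReal.ofReal p.2 *
      expNeg (ENNReal.ofReal p.2 * N.interference L p.1) :=
    (ENNReal.measurable_ofReal.comp measurable_snd).mul hm
  simp_rw [← lintegral_mul_expNeg]
  rw [lintegral_lintegral_swap hm2.aemeasurable]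
  refine lintegral_congr fun t => ?_
  rw [lintegral_const_mul' _ _ ENNReal.ofReal_ne_top]

variable [IsProbabilityMeasure H] [IsProbabilityMeasure σ]

lemma lintegral_inv_sq_interference_le (hN : N.IsPoissonNetwork P H σ lam) (hlam : 0 ≤ lam)
    (hL : Measurable (Function.uncurry L)) :
    ∫⁻ ω, (N.interference L ω ^ 2)⁻¹ ∂P ≤ negativeMomentSum (H.prod σ) L lam := by
  rw [hN.lintegral_inv_sq_interference hL, negativeMomentSum_eq _ hL]
  exact lintegral_mono fun t =>
    mul_le_mul_right (hN.lintegral_expNeg_interference_le hlam hL _) _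

lemma le_lintegral_inv_sq_interference (hN : N.IsPoissonNetwork P H σ lam) (hlam : 0 ≤ lam)
    (hL : Measurable (Function.uncurry L)) :
    ENNReal.ofReal (lam * Real.exp (-lam)) * negativeMomentSum (H.prod σ) L lam ≤
      ∫⁻ ω, (N.interference L ω ^ 2)⁻¹ ∂P := by
  rw [hN.lintegral_inv_sq_interference hL, negativeMomentSum_eq _ hL,
    ← lintegral_const_mul' _ _ ENNReal.ofReal_ne_top]
  refine lintegral_mono fun t => ?_
  rw [mul_left_comm]
  exact mul_le_mul_right (hN.le_lintegral_expNeg_interference hlam hL _) _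

end Network.IsPoissonNetwork


/-! ### Path loss functions with a tail minorant -/

/-- Otherwise the mean would be at most `1 / 2`. -/
lemma IsFadingLaw.measure_Ici_half_pos {H : Measure ℝ} (hH : IsFadingLaw H) :
    0 < H (Ici (1 / 2 : ℝ)) := by
  have := hH.isProbabilityMeasure
  rw [pos_iff_ne_zero]
  intro h0
  have h1 : ∀ᵐ t ∂H, ENNReal.ofReal t ≤ ENNReal.ofReal (1 / 2) := by
    have : ∀ᵐ t ∂H, t ∉ Ici (1 / 2 : ℝ) := measure_eq_zero_iff_ae_notMem.1 h0
    filter_upwards [this] with t ht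
    exact ENNReal.ofReal_le_ofReal (not_le.1 ht).le
  have h2 := lintegral_mono_ae h1
  rw [hH.mean_one, lintegral_const, measure_univ, mul_one, ← ENNReal.ofReal_one,
    ENNReal.ofReal_le_ofReal_iff (by norm_num)] at h2
  norm_num at h2

/-- A Grönwall argument: the differential inequality says that `f r * exp(r² / (2ζ))` is
nondecreasing. -/
lemma mul_exp_le_of_derivWithin_le {ρ ζ : ℝ} {f : ℝ → ℝ} (hζ : 0 < ζ)
    (hf : DifferentiableOn ℝ f (Ici ρ))
    (hf' : ∀ r, ρ ≤ r → ζ * (-derivWithin f (Ici ρ) r) ≤ r * f r) {a r : ℝ} (ha : ρ ≤ a)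
    (har : a ≤ r) : f a * Real.exp (-((r ^ 2 - a ^ 2) / (2 * ζ))) ≤ f r := by
  have hmono : MonotoneOn (fun r => f r * Real.exp (r ^ 2 / (2 * ζ))) (Ici ρ) := by
    refine monotoneOn_of_deriv_nonneg (convex_Ici ρ) ?_ ?_ ?_
    · exact hf.continuousOn.mul (by fun_prop)
    · exact (hf.mono interior_subset).mul (by fun_prop)
    · intro s hs
      rw [interior_Ici] at hs
      have hs' : ρ < s := hs
      have hd : HasDerivAt f (derivWithin f (Ici ρ) s) s :=
        (hf s hs'.le).hasDerivWithinAt.hasDerivAt (Ici_mem_nhds hs')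
      have he : HasDerivAt (fun r : ℝ => Real.exp (r ^ 2 / (2 * ζ)))
          (Real.exp (s ^ 2 / (2 * ζ)) * (2 * s / (2 * ζ))) s := by
        have := ((hasDerivAt_pow 2 s).div_const (2 * ζ)).exp
        simpa using this
      rw [(hd.fun_mul he).deriv]
      have h1 : 0 ≤ derivWithin f (Ici ρ) s + f s * (s / ζ) := by
        have := hf' s hs'.le
        have h2 : f s * (s / ζ) = s * f s / ζ := by ring
        have h3 : -derivWithin f (Ici ρ) s ≤ s * f s / ζ := by
          rw [le_div_iff₀ hζ]; linarith
        rw [h2]; linarith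
      have h3 : derivWithin f (Ici ρ) s * Real.exp (s ^ 2 / (2 * ζ)) +
          f s * (Real.exp (s ^ 2 / (2 * ζ)) * (2 * s / (2 * ζ))) =
          Real.exp (s ^ 2 / (2 * ζ)) * (derivWithin f (Ici ρ) s + f s * (s / ζ)) := by
        field_simp
      rw [h3]
      positivity
  have h := hmono (mem_Ici.2 ha) (mem_Ici.2 (ha.trans har)) har
  simp only at h
  have h2 : Real.exp (-((r ^ 2 - a ^ 2) / (2 * ζ))) =
      Real.exp (a ^ 2 / (2 * ζ)) * Real.exp (-(r ^ 2 / (2 * ζ))) := by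
    rw [← Real.exp_add]; congr 1; ring
  rw [h2, ← mul_assoc]
  calc _ ≤ f r * Real.exp (r ^ 2 / (2 * ζ)) * Real.exp (-(r ^ 2 / (2 * ζ))) := by gcongr
    _ = f r := by rw [mul_assoc, ← Real.exp_add, add_neg_cancel, Real.exp_zero, mul_one]

/-- The radius of the open disk of area `k`. -/
def diskRadius (k : ℕ) : ℝ := √(k / Real.pi)

lemma diskRadius_nonneg (k : ℕ) : 0 ≤ diskRadius k := Real.sqrt_nonneg _

lemma pi_mul_diskRadius_sq (k : ℕ) : Real.pi * diskRadius k ^ 2 = k := by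
  rw [diskRadius, Real.sq_sqrt (by positivity), mul_div_cancel₀ _ Real.pi_ne_zero]

lemma diskRadius_mono : Monotone diskRadius := fun a b h => by
  unfold diskRadius; gcongr

lemma diskRadius_le_norm {k : ℕ} {y : Plane} (hy : y ∉ disk k) : diskRadius k ≤ ‖y‖ := by
  rw [mem_disk, not_lt] at hy
  rw [diskRadius, Real.sqrt_le_left (norm_nonneg y), div_le_iff₀' Real.pi_pos]
  exact hy

section FarExponent

variable {S : Type*} [MeasurableSpace S] {L : S → ℝ → ℝ} {H : Measure ℝ} {σ : Measure S}
  {ρ ζ : ℝ} {f : ℝ → ℝ}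

lemma farExponent_antitone (μ : Measure (ℝ × S)) (L : S → ℝ → ℝ) (t : ℝ≥0∞) :
    Antitone fun k => farExponent μ L k t := fun _ _ h =>
  lintegral_mono_set (compl_subset_compl.2 (disk_mono (Nat.succ_le_succ h)))

/-- Put `a = diskRadius (k + 1)` and `c = f a * t / 2`. On an annulus beyond `a` whose area is
proportional to `log c`, the path loss is still at least `f a / c = 2 / t`, so fading at least `1 /
2` makes the exponent at least `1`. -/
lemma le_farExponent [IsProbabilityMeasure H] [IsProbabilityMeasure σ] (hζ : 0 < ζ)
    (hf : DifferentiableOn ℝ f (Ici ρ))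
    (hf' : ∀ r, ρ ≤ r → ζ * (-derivWithin f (Ici ρ) r) ≤ r * f r)
    (hfL : ∀ s r, ρ ≤ r → f r ≤ L s r) {k : ℕ} (hk : ρ ≤ diskRadius (k + 1)) {t : ℝ}
    (ht : 0 < t) (hc : 1 ≤ f (diskRadius (k + 1)) / 2 * t) :
    ENNReal.ofReal ((H (Ici (1 / 2 : ℝ))).toReal * (1 - Real.exp (-1)) * (2 * Real.pi * ζ) *
      Real.log (f (diskRadius (k + 1)) / 2 * t)) ≤
      farExponent (H.prod σ) L k (ENNReal.ofReal t) := by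
  set a := diskRadius (k + 1) with ha
  set c := f a / 2 * t with hcdef
  -- With this area, the decay bound loses at most a factor `c` across the annulus.
  set v : ℝ := 2 * Real.pi * ζ * Real.log c with hv
  have hlog : 0 ≤ Real.log c := Real.log_nonneg hc
  have hv0 : 0 ≤ v := by positivity
  have hq : 0 ≤ 1 - Real.exp (-1) := by
    have := Real.exp_le_one_iff.2 (show (-1 : ℝ) ≤ 0 by norm_num)
    linarith
  set T : Set Plane := {y | Real.pi * ‖y‖ ^ 2 < ((k + 1 : ℕ) : ℝ) + v} \ disk (k + 1) with hT
  have hTm : MeasurableSet T :=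
    (measurableSet_lt (by fun_prop) measurable_const).diff (measurableSet_disk _)
  have hTv : volume T = ENNReal.ofReal v := by
    rw [hT, measure_sdiff _ (measurableSet_disk _).nullMeasurableSet (by simp [volume_disk]),
      volume_setOf_norm_sq_lt, volume_disk, ENNReal.ofReal_add (by positivity) hv0,
      ENNReal.ofReal_natCast, ENNReal.add_sub_cancel_left (ENNReal.natCast_ne_top _)]
    intro y hy
    have := mem_disk.1 hy
    change Real.pi * ‖y‖ ^ 2 < _
    linarith
  have hin : ∀ y ∈ T, ∀ m ∈ Ici (1 / 2 : ℝ) ×ˢ (univ : Set S),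
      ENNReal.ofReal (1 - Real.exp (-1)) ≤
        1 - expNeg (ENNReal.ofReal t * receivedPower L y m) := by
    intro y hy m hm
    have hm1 : 1 / 2 ≤ m.1 := hm.1
    have hay : a ≤ ‖y‖ := diskRadius_le_norm hy.2
    have h1 : Real.pi * ‖y‖ ^ 2 < ((k + 1 : ℕ) : ℝ) + v := hy.1
    rw [← pi_mul_diskRadius_sq, ← ha, hv] at h1
    have h2 : ‖y‖ ^ 2 < a ^ 2 + 2 * ζ * Real.log c := by
      refine lt_of_mul_lt_mul_left ?_ Real.pi_pos.le
      linarith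
    have h3 : (‖y‖ ^ 2 - a ^ 2) / (2 * ζ) ≤ Real.log c := by
      rw [div_le_iff₀ (by positivity)]; linarith
    have hfa : 0 < f a := by
      have : 0 < c := one_pos.trans_le hc
      rw [hcdef] at this
      have := (pos_iff_pos_of_mul_pos this).2 ht
      linarith
    have h4 : f a / c ≤ L m.2 ‖y‖ := by
      calc f a / c = f a * Real.exp (-Real.log c) := by
            rw [Real.exp_neg, Real.exp_log (one_pos.trans_le hc), div_eq_mul_inv]
        _ ≤ f a * Real.exp (-((‖y‖ ^ 2 - a ^ 2) / (2 * ζ))) := by gcongr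
        _ ≤ f ‖y‖ := mul_exp_le_of_derivWithin_le hζ hf hf' hk hay
        _ ≤ L m.2 ‖y‖ := hfL _ _ (hk.trans hay)
    have h5 : 1 ≤ t * (m.1 * L m.2 ‖y‖) := by
      have h6 : t * (1 / 2 * (f a / c)) = 1 := by
        rw [hcdef]; field_simp
      rw [← h6]
      have : 0 ≤ f a / c := div_nonneg hfa.le (zero_le_one.trans hc)
      gcongr
    rw [receivedPower, ← ENNReal.ofReal_mul ht.le, ENNReal.ofReal_sub _ (Real.exp_nonneg _),
      ENNReal.ofReal_one, ← expNeg_ofReal zero_le_one]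
    exact tsub_le_tsub_left (expNeg_antitone (ENNReal.ofReal_le_ofReal h5)) _
  have hprod : (H.prod σ) (Ici (1 / 2 : ℝ) ×ˢ (univ : Set S)) =
      ENNReal.ofReal (H (Ici (1 / 2 : ℝ))).toReal := by
    rw [Measure.prod_prod, measure_univ, mul_one, ENNReal.ofReal_toReal (measure_ne_top _ _)]
  calc _ = ENNReal.ofReal (1 - Real.exp (-1)) *
        (H.prod σ) (Ici (1 / 2 : ℝ) ×ˢ (univ : Set S)) * volume T := by
        rw [hprod, hTv, ← ENNReal.ofReal_mul hq, ← ENNReal.ofReal_mul (by positivity)]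
        congr 1
        rw [hv]; ring
    _ = ∫⁻ _ in T, ∫⁻ _ in Ici (1 / 2 : ℝ) ×ˢ (univ : Set S),
        ENNReal.ofReal (1 - Real.exp (-1)) ∂(H.prod σ) := by simp
    _ ≤ ∫⁻ y in T, ∫⁻ m, (1 - expNeg (ENNReal.ofReal t * receivedPower L y m)) ∂(H.prod σ) := by
        refine setLIntegral_mono' hTm fun y hy => ?_
        exact (setLIntegral_mono' (measurableSet_Ici.prod MeasurableSet.univ) (hin y hy)).trans
          (setLIntegral_le_lintegral _ _)
    _ ≤ _ := lintegral_mono_set fun y hy => hy.2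

lemma mul_exp_neg_mul_log_le {β c : ℝ} (hβ : 3 ≤ β) (hc : 1 ≤ c) :
    c * Real.exp (-(β * Real.log c)) ≤ 2 / (1 + c ^ 2) := by
  have hc0 : 0 < c := one_pos.trans_le hc
  have h1 : Real.exp (-(β * Real.log c)) ≤ (c ^ 3)⁻¹ := by
    rw [← Real.exp_log (pow_pos hc0 3), ← Real.exp_neg, Real.log_pow]
    have := Real.log_nonneg hc
    gcongr
    push_cast
    nlinarith
  calc c * Real.exp (-(β * Real.log c)) ≤ c * (c ^ 3)⁻¹ := by gcongr
    _ = 1 / c ^ 2 := by field_simp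
    _ ≤ 2 / (1 + c ^ 2) := by
      rw [div_le_div_iff₀ (by positivity) (by positivity)]
      nlinarith

lemma lintegral_two_div_one_add_sq_lt_top :
    ∫⁻ s in Ioi (0 : ℝ), ENNReal.ofReal (2 / (1 + s ^ 2)) < ∞ := by
  have h : Integrable fun s : ℝ => 2 / (1 + s ^ 2) := by
    simpa [div_eq_mul_inv] using integrable_inv_one_add_sq.const_mul 2
  exact (h.integrableOn (s := Ioi 0)).lintegral_lt_top

/-- With `s = f a * t / 2`, the exponential is at most `s⁻³` for `s ≥ 1` by `hβ` and at most `1`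
below, so `s` times it is dominated by `2 / (1 + s²)`; the two rescalings produce `4 / f(a)²`. -/
lemma lintegral_expNeg_farExponent_le [IsProbabilityMeasure H] [IsProbabilityMeasure σ]
    (hζ : 0 < ζ) (hf : DifferentiableOn ℝ f (Ici ρ))
    (hf' : ∀ r, ρ ≤ r → ζ * (-derivWithin f (Ici ρ) r) ≤ r * f r)
    (hf0 : ∀ r, ρ ≤ r → 0 ≤ f r) (hfL : ∀ s r, ρ ≤ r → f r ≤ L s r) {lam : ℝ} (hlam : 0 ≤ lam)
    (hβ : 3 ≤ lam * ((H (Ici (1 / 2 : ℝ))).toReal * (1 - Real.exp (-1)) * (2 * Real.pi * ζ)))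
    {k : ℕ} (hk : ρ ≤ diskRadius (k + 1)) :
    ∫⁻ t in Ioi (0 : ℝ), ENNReal.ofReal t *
        expNeg (ENNReal.ofReal lam * farExponent (H.prod σ) L k (ENNReal.ofReal t)) ≤
      4 * (∫⁻ s in Ioi (0 : ℝ), ENNReal.ofReal (2 / (1 + s ^ 2))) *
        (ENNReal.ofReal (f (diskRadius (k + 1))) ^ 2)⁻¹ := by
  set a := diskRadius (k + 1) with ha
  set J := ∫⁻ s in Ioi (0 : ℝ), ENNReal.ofReal (2 / (1 + s ^ 2)) with hJ
  rcases (hf0 a hk).eq_or_lt with h0 | hpos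
  -- If `f a = 0` the right side is `∞`, but only because `J ≠ 0`: in `[0, ∞]` one has `0 * ∞ = 0`.
  · have hJ0 : J ≠ 0 := by
      have hsub : ∫⁻ s in Ioc (0 : ℝ) 1, ENNReal.ofReal 1 ≤ J := by
        refine le_trans (setLIntegral_mono' measurableSet_Ioc fun s hs => ?_)
          (lintegral_mono_set Ioc_subset_Ioi_self)
        refine ENNReal.ofReal_le_ofReal ?_
        rw [le_div_iff₀ (by positivity)]
        nlinarith [hs.1, hs.2]
      intro h
      rw [h] at hsub
      simp at hsub
    rw [← h0]
    simp [ENNReal.mul_top, hJ0]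
  set b := f a / 2 with hb
  have hb0 : 0 < b := by positivity
  set q := (H (Ici (1 / 2 : ℝ))).toReal * (1 - Real.exp (-1)) * (2 * Real.pi * ζ) with hq
  calc _ ≤ ∫⁻ t in Ioi (0 : ℝ), ENNReal.ofReal b⁻¹ *
        ENNReal.ofReal (2 / (1 + (b * t) ^ 2)) := by
        refine setLIntegral_mono' measurableSet_Ioi fun t ht => ?_
        have ht' : 0 < t := ht
        have htb : t = b⁻¹ * (b * t) := by field_simp
        rw [← ENNReal.ofReal_mul (by positivity)]
        rcases le_total (b * t) 1 with h | h
        · refine (mul_le_of_le_one_right' (expNeg_le_one _)).trans ?_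
          refine ENNReal.ofReal_le_ofReal ?_
          nth_rewrite 1 [htb]
          refine mul_le_mul_of_nonneg_left ?_ (by positivity)
          have : 0 < b * t := by positivity
          rw [le_div_iff₀ (by positivity)]
          nlinarith
        · have hlog := Real.log_nonneg h
          have h1 := le_farExponent (H := H) (σ := σ) hζ hf hf' hfL hk ht' h
          rw [← ha, ← hb, ← hq] at h1
          have hβ0 : 0 ≤ lam * (q * Real.log (b * t)) := by
            rw [← mul_assoc]; exact mul_nonneg (by linarith) hlog
          have h2 : expNeg (ENNReal.ofReal lam * farExponent (H.prod σ) L k (ENNReal.ofReal t)) ≤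
              ENNReal.ofReal (Real.exp (-(lam * q * Real.log (b * t)))) := by
            rw [mul_assoc lam, ← expNeg_ofReal hβ0, ENNReal.ofReal_mul hlam]
            exact expNeg_antitone (mul_le_mul_right h1 _)
          refine (mul_le_mul_right h2 _).trans ?_
          rw [← ENNReal.ofReal_mul ht'.le]
          refine ENNReal.ofReal_le_ofReal ?_
          nth_rewrite 1 [htb]
          rw [mul_assoc]
          exact mul_le_mul_of_nonneg_left (mul_exp_neg_mul_log_le hβ h) (by positivity)
    _ = ENNReal.ofReal b⁻¹ * (ENNReal.ofReal b⁻¹ * J) := by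
        rw [lintegral_const_mul' _ _ ENNReal.ofReal_ne_top,
          lintegral_Ioi_comp_mul_left hb0 fun s => ENNReal.ofReal (2 / (1 + s ^ 2))]
    _ = _ := by
        have h4 : (4 : ℝ≥0∞) = ENNReal.ofReal 4 := by simp
        rw [← ENNReal.ofReal_pow hpos.le, ← ENNReal.ofReal_inv_of_pos (by positivity),
          ← mul_assoc, ← ENNReal.ofReal_mul (by positivity), h4, mul_right_comm,
          ← ENNReal.ofReal_mul (by positivity)]
        congr 2
        rw [hb]; field_simp; norm_num

lemma lintegral_Ioc_diskRadius (k : ℕ) :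
    ∫⁻ r in Ioc (diskRadius k) (diskRadius (k + 1)), ENNReal.ofReal r =
      ENNReal.ofReal (1 / (2 * Real.pi)) := by
  have hle := diskRadius_mono k.le_succ
  have hi : IntervalIntegrable (fun r : ℝ => r) volume (diskRadius k) (diskRadius (k + 1)) :=
    continuous_id.intervalIntegrable _ _
  rw [← ofReal_integral_eq_lintegral_ofReal
    ((intervalIntegrable_iff_integrableOn_Ioc_of_le hle).1 hi),
    ← intervalIntegral.integral_of_le hle, integral_id]
  · congr 1
    have h1 := pi_mul_diskRadius_sq k
    have h2 := pi_mul_diskRadius_sq (k + 1)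
    push_cast at h2
    have := Real.pi_pos
    field_simp
    linarith
  · filter_upwards [ae_restrict_mem measurableSet_Ioc] with r hr
    exact (diskRadius_nonneg k).trans hr.1.le

/-- Term `k = j + K` is compared with the shell just outside `diskRadius (k + 1)`, where `f` is
smaller and `π r² ≤ k + 2`; this costs `exp(-2 lam)`, and `1 / (2π)` is the integral of `r` over a
shell. -/
lemma tsum_inv_sq_le_lintegral (hanti : AntitoneOn f (Ici ρ)) {lam : ℝ} (hlam : 0 ≤ lam) {K : ℕ}
    (hK : ρ ≤ diskRadius (K + 1)) :
    ENNReal.ofReal (1 / (2 * Real.pi) * Real.exp (-(2 * lam))) *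
        ∑' j : ℕ, expNeg (ENNReal.ofReal lam * (j + K : ℕ)) *
          (ENNReal.ofReal (f (diskRadius (j + K + 1))) ^ 2)⁻¹ ≤
      ∫⁻ r in Ici ρ, ENNReal.ofReal r / ENNReal.ofReal (f r) ^ 2 *
        ENNReal.ofReal (Real.exp (-Real.pi * lam * r ^ 2)) := by
  set I : ℕ → Set ℝ := fun j => Ioc (diskRadius (j + K + 1)) (diskRadius (j + K + 1 + 1)) with hI
  have hdisj : Pairwise (Function.onFun Disjoint I) := by
    have hm : Monotone fun j => diskRadius (j + K + 1) := fun i j h =>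
      diskRadius_mono (by omega)
    have := hm.pairwise_disjoint_on_Ioc_succ
    convert this using 4
    simp [add_right_comm]
  have hρ : ∀ j, ρ ≤ diskRadius (j + K + 1) := fun j => hK.trans (diskRadius_mono (by omega))
  have hsub : (⋃ j, I j) ⊆ Ici ρ := iUnion_subset fun j r hr => (hρ j).trans hr.1.le
  refine le_trans ?_ (lintegral_mono_set hsub)
  rw [lintegral_iUnion (fun j => measurableSet_Ioc) hdisj, ← ENNReal.tsum_mul_left]
  refine ENNReal.tsum_le_tsum fun j => ?_
  set B := (ENNReal.ofReal (f (diskRadius (j + K + 1))) ^ 2)⁻¹ with hB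
  calc _ = ∫⁻ r in I j, ENNReal.ofReal r * (B *
        ENNReal.ofReal (Real.exp (-(lam * (j + K + 2))))) := by
        rw [lintegral_mul_const _ ENNReal.measurable_ofReal, hI, lintegral_Ioc_diskRadius,
          ← ENNReal.ofReal_natCast, ← ENNReal.ofReal_mul hlam, expNeg_ofReal (by positivity),
          mul_comm _ B, mul_left_comm, ← ENNReal.ofReal_mul (by positivity),
          mul_left_comm, ← ENNReal.ofReal_mul (by positivity), mul_assoc (1 / (2 * Real.pi)),
          ← Real.exp_add]
        congr 4
        push_cast
        ring
    _ ≤ _ := by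
        refine setLIntegral_mono' measurableSet_Ioc fun r hr => ?_
        rw [div_eq_mul_inv, mul_assoc]
        refine mul_le_mul_right (mul_le_mul' ?_ ?_) _
        · rw [hB]
          refine ENNReal.inv_le_inv.2 (pow_le_pow_left' (ENNReal.ofReal_le_ofReal ?_) 2)
          exact hanti (hρ j) ((hρ j).trans hr.1.le) hr.1.le
        · refine ENNReal.ofReal_le_ofReal (Real.exp_le_exp.2 ?_)
          have h2 := pi_mul_diskRadius_sq (j + K + 1 + 1)
          have h3 : r ^ 2 ≤ diskRadius (j + K + 1 + 1) ^ 2 :=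
            pow_le_pow_left₀ ((diskRadius_nonneg _).trans hr.1.le) hr.2 2
          have h4 : Real.pi * r ^ 2 ≤ j + K + 2 := by
            have := mul_le_mul_of_nonneg_left h3 Real.pi_pos.le
            rw [h2] at this
            push_cast at this
            linarith
          nlinarith

theorem HasTailMinorant.exists_negativeMomentSum_lt_top (hLt : HasTailMinorant L)
    (hH : IsFadingLaw H) [IsProbabilityMeasure σ] :
    ∃ lam, 0 < lam ∧ negativeMomentSum (H.prod σ) L lam < ∞ := by
  have := hH.isProbabilityMeasure
  obtain ⟨ρ, ζ, f, hρ, hζ, hf, hanti, hf0, hfL, hf', lamc, hlamc, hint⟩ := hLt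
  set q := (H (Ici (1 / 2 : ℝ))).toReal * (1 - Real.exp (-1)) * (2 * Real.pi * ζ) with hq
  have hq0 : 0 < q := by
    have h1 : 0 < (H (Ici (1 / 2 : ℝ))).toReal :=
      ENNReal.toReal_pos hH.measure_Ici_half_pos.ne' (measure_ne_top _ _)
    have h2 : 0 < 1 - Real.exp (-1) := by
      have := Real.exp_lt_one_iff.2 (show (-1 : ℝ) < 0 by norm_num)
      linarith
    have := Real.pi_pos
    positivity
  -- Large enough both for the integral hypothesis and for the exponent `lam * q` to be at least
  -- `3`.
  set lam := lamc + 3 / q with hlam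
  have hlq : 0 < 3 / q := by positivity
  have hlam0 : 0 < lam := by positivity
  have hβ : 3 ≤ lam * q := by
    rw [hlam, add_mul, div_mul_cancel₀ _ hq0.ne']
    have := mul_nonneg hlamc hq0.le
    linarith
  obtain ⟨K, hK⟩ := exists_nat_gt (Real.pi * ρ ^ 2)
  have hK' : ρ ≤ diskRadius (K + 1) := by
    rw [diskRadius]
    refine Real.le_sqrt_of_sq_le ?_
    rw [le_div_iff₀' Real.pi_pos]
    push_cast
    linarith
  refine ⟨lam, hlam0, ?_⟩
  set J := ∫⁻ s in Ioi (0 : ℝ), ENNReal.ofReal (2 / (1 + s ^ 2)) with hJ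
  set Q : ℕ → ℝ≥0∞ := fun k => ∫⁻ t in Ioi (0 : ℝ), ENNReal.ofReal t *
    expNeg (ENNReal.ofReal lam * farExponent (H.prod σ) L k (ENNReal.ofReal t)) with hQ
  have hQmono : Monotone Q := fun i j h => lintegral_mono fun t =>
    mul_le_mul_right (expNeg_antitone (mul_le_mul_right (farExponent_antitone _ _ _ h) _)) _
  have htail : ∑' j : ℕ, expNeg (ENNReal.ofReal lam * (j + K : ℕ)) * Q (j + K) < ∞ := by
    have h1 := (tsum_inv_sq_le_lintegral hanti hlam0.le hK').trans_lt
      (hint lam (by rw [hlam]; linarith))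
    have h2 : ∑' j : ℕ, expNeg (ENNReal.ofReal lam * (j + K : ℕ)) *
          (ENNReal.ofReal (f (diskRadius (j + K + 1))) ^ 2)⁻¹ < ∞ :=
      ENNReal.lt_top_of_mul_ne_top_right h1.ne (by
        rw [ENNReal.ofReal_ne_zero_iff]
        have := Real.pi_pos
        positivity)
    refine lt_of_le_of_lt ?_ (ENNReal.mul_lt_top (ENNReal.mul_lt_top (ENNReal.ofNat_lt_top (n := 4))
      lintegral_two_div_one_add_sq_lt_top) h2)
    rw [← ENNReal.tsum_mul_left]
    refine ENNReal.tsum_le_tsum fun j => ?_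
    rw [mul_left_comm]
    exact mul_le_mul_right (lintegral_expNeg_farExponent_le hζ hf hf' hf0 hfL hlam0.le hβ
      (hK'.trans (diskRadius_mono (by omega)))) _
  -- The finitely many annuli not known to lie beyond `ρ` are controlled by `Q K`, since `Q` is
  -- monotone; `Q K` is finite by the first tail term.
  have hQK : Q K < ∞ := by
    have h1 := (ENNReal.le_tsum (f := fun j : ℕ =>
      expNeg (ENNReal.ofReal lam * (j + K : ℕ)) * Q (j + K)) 0).trans_lt htail
    rw [zero_add] at h1
    refine ENNReal.lt_top_of_mul_ne_top_right h1.ne ?_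
    rw [← ENNReal.ofReal_natCast, ← ENNReal.ofReal_mul hlam0.le, expNeg_ofReal (by positivity),
      ENNReal.ofReal_ne_zero_iff]
    exact Real.exp_pos _
  rw [negativeMomentSum, ← ENNReal.summable.sum_add_tsum_nat_add' (k := K)]
  refine ENNReal.add_lt_top.2 ⟨ENNReal.sum_lt_top.2 fun k hk => ?_, htail⟩
  refine lt_of_le_of_lt ?_ hQK
  exact (mul_le_of_le_one_left' (expNeg_le_one _)).trans (hQmono (Finset.mem_range.1 hk).le)

end FarExponent


/-! ### The constrained area spectral efficiency -/

lemma log2OnePlus_le (y : ℝ≥0∞) : log2OnePlus y ≤ 2 * y := by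
  rw [log2OnePlus]
  split_ifs with h
  · simp [h]
  · nth_rewrite 2 [← ENNReal.ofReal_toReal h]
    rw [show (2 : ℝ≥0∞) = ENNReal.ofReal 2 by simp, ← ENNReal.ofReal_mul zero_le_two]
    refine ENNReal.ofReal_le_ofReal ?_
    have hy : 0 ≤ y.toReal := ENNReal.toReal_nonneg
    have h2 : 1 / 2 ≤ Real.log 2 := by linarith [Real.log_two_gt_d9]
    rw [Real.logb, div_le_iff₀ (by linarith)]
    have := Real.log_le_sub_one_of_pos (show 0 < 1 + y.toReal by linarith)
    nlinarith

section Tail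

variable {Ω : Type*} [MeasurableSpace Ω] {P : Measure Ω}

lemma tendsto_lintegral_indicator_sqrt {X : Ω → ℝ≥0∞} (hX : Measurable X)
    (hX' : ∫⁻ ω, X ω ∂P ≠ ∞) {θ : ℝ} (hθ : 0 < θ) :
    Tendsto (fun lam : ℝ => ∫⁻ ω, {ω | ENNReal.ofReal √(θ * lam) ≤ X ω}.indicator X ω ∂P)
      atTop (𝓝 0) := by
  have hv : Tendsto (fun lam : ℝ => √(θ * lam)) atTop atTop :=
    Real.tendsto_sqrt_atTop.comp (tendsto_id.const_mul_atTop hθ)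
  have h := tendsto_lintegral_filter_of_dominated_convergence (μ := P) (l := atTop)
    (F := fun (lam : ℝ) ω => {ω | ENNReal.ofReal √(θ * lam) ≤ X ω}.indicator X ω)
    (f := fun _ => 0) X
    (Eventually.of_forall fun lam => hX.indicator (measurableSet_le measurable_const hX))
    (Eventually.of_forall fun lam => ae_of_all _ fun ω => indicator_le_self _ _ _) hX' ?_
  · simpa using h
  · filter_upwards [ae_lt_top hX hX'] with ω hω
    refine tendsto_const_nhds.congr' ?_
    filter_upwards [hv.eventually_gt_atTop (X ω).toReal] with lam hlam
    have h : ω ∉ {ω | ENNReal.ofReal √(θ * lam) ≤ X ω} :=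
      fun h => absurd h (not_le.2 ((ENNReal.lt_ofReal_iff_toReal_lt hω.ne).2 hlam))
    rw [indicator_of_notMem h]

/-- A product of at least `v²` has a factor of at least `v`. Independence splits each case, and the
second moment of `Y` controls both its mean, by `Y ≤ 1 + Y²`, and its tail, by `Y ≤ Y² / v` where `Y
≥ v`. -/
lemma lintegral_mul_indicator_le [IsProbabilityMeasure P] {X Y : Ω → ℝ≥0∞} (hX : Measurable X)
    (hY : Measurable Y) (hXY : IndepFun X Y P) {v : ℝ} (hv : 0 < v) :
    ∫⁻ ω, {ω | ENNReal.ofReal (v ^ 2) ≤ X ω * Y ω}.indicator (fun ω => X ω * Y ω) ω ∂P ≤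
      (∫⁻ ω, {ω | ENNReal.ofReal v ≤ X ω}.indicator X ω ∂P) * (1 + ∫⁻ ω, Y ω ^ 2 ∂P) +
        (∫⁻ ω, X ω ∂P) * (ENNReal.ofReal v⁻¹ * ∫⁻ ω, Y ω ^ 2 ∂P) := by
  set φ : ℝ≥0∞ → ℝ≥0∞ := (Ici (ENNReal.ofReal v)).indicator id
  have hφ : Measurable φ := measurable_id.indicator measurableSet_Ici
  have hφX : ∀ ω, {ω | ENNReal.ofReal v ≤ X ω}.indicator X ω = φ (X ω) := fun ω => rfl
  have hφY : ∀ ω, φ (Y ω) ≤ ENNReal.ofReal v⁻¹ * Y ω ^ 2 := by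
    intro ω
    by_cases h : ENNReal.ofReal v ≤ Y ω
    · rw [show φ (Y ω) = Y ω from indicator_of_mem (mem_Ici.2 h) _, sq, ← mul_assoc]
      refine le_mul_of_one_le_left' ?_
      calc (1 : ℝ≥0∞) = ENNReal.ofReal v⁻¹ * ENNReal.ofReal v := by
            rw [← ENNReal.ofReal_mul (by positivity), inv_mul_cancel₀ hv.ne', ENNReal.ofReal_one]
        _ ≤ _ := by gcongr
    · rw [show φ (Y ω) = 0 from indicator_of_notMem (mt mem_Ici.1 h) _]
      exact zero_le
  have hY1 : ∀ ω, Y ω ≤ 1 + Y ω ^ 2 := by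
    intro ω
    rcases le_total (Y ω) 1 with h | h
    · exact h.trans le_self_add
    · exact (le_self_pow₀ h two_ne_zero).trans le_add_self
  have hpt : ∀ ω, {ω | ENNReal.ofReal (v ^ 2) ≤ X ω * Y ω}.indicator (fun ω => X ω * Y ω) ω ≤
      φ (X ω) * Y ω + X ω * φ (Y ω) := by
    intro ω
    refine indicator_le (s := {ω | ENNReal.ofReal (v ^ 2) ≤ X ω * Y ω})
      (g := fun ω => φ (X ω) * Y ω + X ω * φ (Y ω)) (fun ω hω => ?_) ω
    by_cases h : ENNReal.ofReal v ≤ X ω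
    · rw [show φ (X ω) = X ω from indicator_of_mem (mem_Ici.2 h) _]
      exact le_self_add
    · have h2 : ENNReal.ofReal v ≤ Y ω := by
        by_contra h3
        have hω' : ENNReal.ofReal (v ^ 2) ≤ X ω * Y ω := hω
        refine absurd hω' (not_le.2 ?_)
        rw [sq, ENNReal.ofReal_mul hv.le]
        exact ENNReal.mul_lt_mul (not_le.1 h) (not_le.1 h3)
      rw [show φ (Y ω) = Y ω from indicator_of_mem (mem_Ici.2 h2) _]
      exact le_add_self
  refine (lintegral_mono hpt).trans ?_
  have hm : Measurable fun ω => φ (X ω) * Y ω := (hφ.comp hX).mul hY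
  rw [lintegral_add_left hm]
  refine add_le_add ?_ ?_
  · have := lintegral_mul_eq_lintegral_mul_lintegral_of_indepFun (hφ.comp hX) hY
      (hXY.comp hφ measurable_id)
    simp only [Pi.mul_apply, Function.comp_apply] at this
    rw [this]
    simp_rw [hφX]
    refine mul_le_mul_right ((lintegral_mono hY1).trans_eq ?_) _
    rw [lintegral_add_left measurable_const]
    simp
  · have := lintegral_mul_eq_lintegral_mul_lintegral_of_indepFun hX (hφ.comp hY)
      (hXY.comp measurable_id hφ)
    simp only [Pi.mul_apply, Function.comp_apply] at this
    rw [this, ← lintegral_const_mul' _ _ ENNReal.ofReal_ne_top]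
    exact mul_le_mul_right (lintegral_mono hφY) _

end Tail

/-- The two hypotheses amount to mutual independence of `A`, `B`, `C`, which allows regrouping. -/
lemma indepFun_prodMk_of_indepFun {Ω α β γ : Type*} [MeasurableSpace Ω] [MeasurableSpace α]
    [MeasurableSpace β] [MeasurableSpace γ] {P : Measure Ω} [IsProbabilityMeasure P] {A : Ω → α}
    {B : Ω → β} {C : Ω → γ} (hA : Measurable A) (hB : Measurable B) (hC : Measurable C)
    (hABC : IndepFun A (fun ω => (B ω, C ω)) P) (hBC : IndepFun B C P) :
    IndepFun B (fun ω => (A ω, C ω)) P := by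
  have := Measure.isProbabilityMeasure_map (μ := P) hA.aemeasurable
  have := Measure.isProbabilityMeasure_map (μ := P) hB.aemeasurable
  have := Measure.isProbabilityMeasure_map (μ := P) hC.aemeasurable
  have e1 := (indepFun_iff_map_prod_eq_prod_map_map hA.aemeasurable
    (hB.prodMk hC).aemeasurable).1 hABC
  rw [(indepFun_iff_map_prod_eq_prod_map_map hB.aemeasurable hC.aemeasurable).1 hBC] at e1
  have e2 := (indepFun_iff_map_prod_eq_prod_map_map hA.aemeasurable hC.aemeasurable).1
    (hABC.comp measurable_id measurable_snd)
  rw [indepFun_iff_measure_inter_preimage_eq_mul]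
  intro s t hs ht
  set D : Set (α × β × γ) := {p | p.2.1 ∈ s ∧ (p.1, p.2.2) ∈ t} with hD
  have hDm : MeasurableSet D :=
    (hs.preimage (measurable_fst.comp measurable_snd)).inter
      (ht.preimage (measurable_fst.prodMk (measurable_snd.comp measurable_snd)))
  calc _ = P.map (fun ω => (A ω, B ω, C ω)) D := by
        rw [Measure.map_apply (hA.prodMk (hB.prodMk hC)) hDm]; rfl
    _ = ∫⁻ a, P.map B s * P.map C (Prod.mk a ⁻¹' t) ∂(P.map A) := by
        rw [e1, Measure.prod_apply hDm]
        refine lintegral_congr fun a => ?_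
        rw [← Measure.prod_prod]
        rfl
    _ = P.map B s * P.map (fun ω => (A ω, C ω)) t := by
        rw [lintegral_const_mul _ (measurable_measure_prodMk_left ht), ← Measure.prod_apply ht]
        congr 2
        exact e2.symm
    _ = _ := by rw [Measure.map_apply hB hs, Measure.map_apply (hA.prodMk hC) ht]

section Network

variable {Ω S : Type*} [MeasurableSpace Ω] [MeasurableSpace S] {P : Measure Ω}
  [IsProbabilityMeasure P] {H : Measure ℝ} {σ : Measure S} {lam : ℝ} {N : Network Ω S} {L : S → ℝ → ℝ}

/-- The interference is a function of all positions and of the marks with index at least `1`, a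
family independent of mark `0`. -/
lemma Network.IsPoissonNetwork.indepFun_mark_interference (hN : N.IsPoissonNetwork P H σ lam)
    (hL : Measurable (Function.uncurry L)) :
    IndepFun (fun ω => (N.h 0 ω, N.s 0 ω)) (N.interference L) P := by
  set m : ℕ → Ω → ℝ × S := fun i ω => (N.h i ω, N.s i ω) with hm
  have hmm : ∀ i, Measurable (m i) := hN.measurable_mark
  have hx : Measurable fun ω i => N.x i ω := measurable_pi_iff.2 hN.ppp.measurable
  have hm' : Measurable fun ω i => m i ω := measurable_pi_iff.2 hmm
  have hs : Measurable fun ω i => m (i + 1) ω := measurable_pi_iff.2 fun i => hmm (i + 1)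
  have h1 : IndepFun (m 0) (fun ω i => m (i + 1) ω) P := by
    have h := indep_iSup_of_disjoint (fun i => (hmm i).comap_le) hN.indep_marks
      (S := {0}) (T := Ici 1) (by simp)
    refine indep_of_indep_of_le_left (indep_of_indep_of_le_right h ?_) ?_
    · rw [MeasurableSpace.pi, MeasurableSpace.comap_iSup]
      refine iSup_le fun i => ?_
      rw [MeasurableSpace.comap_comp]
      exact le_iSup₂_of_le (i + 1) (by simp) le_rfl
    · exact le_iSup₂_of_le 0 rfl le_rfl
  have hF : Measurable fun p : (ℕ → Plane) × (ℕ → ℝ × S) =>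
      ∑' i, receivedPower L (p.1 (i + 1)) (p.2 i) := by
    refine Measurable.tsum fun i => ?_
    have hp : Measurable fun p : (ℕ → Plane) × (ℕ → ℝ × S) => (p.1 (i + 1), p.2 i) := by fun_prop
    exact (measurable_receivedPower hL).comp hp
  have h2 : IndepFun (m 0) (fun ω => (fun i => N.x i ω, fun i => m (i + 1) ω)) P := by
    have hxm : IndepFun (fun ω i => N.x i ω) (fun ω => (m 0 ω, fun i => m (i + 1) ω)) P :=
      hN.indep_positions.comp measurable_id
        (ψ := fun u : ℕ → ℝ × S => (u 0, fun i => u (i + 1))) (by fun_prop)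
    exact indepFun_prodMk_of_indepFun hx (hmm 0) hs hxm h1
  exact h2.comp measurable_id hF

variable [IsProbabilityMeasure H] [IsProbabilityMeasure σ]

/-- An upper bound for the power received from the serving station with fading `t`. -/
def servingBound (L₀ t : ℝ) : ℝ≥0∞ := ENNReal.ofReal t * ENNReal.ofReal L₀

lemma measurable_servingBound (L₀ : ℝ) : Measurable (servingBound L₀) :=
  ENNReal.measurable_ofReal.mul_const _

/-- Bounding the serving path loss by `L₀` removes the serving distance, which is correlated with
the interference; noise is dropped from the denominator. -/
lemma Network.IsPoissonNetwork.constrainedASE_le (hN : N.IsPoissonNetwork P H σ lam)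
    {L₀ : ℝ} (hL : IsPhysicallyFeasible σ L L₀) (N₀ : ℝ) {θ₀ : ℝ} (hθ₀ : 0 < θ₀)
    (hlam : 0 < lam) {C : ℝ≥0∞}
    (hC : ENNReal.ofReal (lam ^ 2) * ∫⁻ ω, (N.interference L ω ^ 2)⁻¹ ∂P ≤ C) :
    constrainedASE P L N₀ lam θ₀ N ≤
      2 * ((∫⁻ t, {t | ENNReal.ofReal √(θ₀ * lam) ≤ servingBound L₀ t}.indicator
          (servingBound L₀) t ∂H) * (1 + C) +
        (∫⁻ t, servingBound L₀ t ∂H) * (ENNReal.ofReal (√(θ₀ * lam))⁻¹ * C)) := by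
  set v := √(θ₀ * lam) with hv
  have hv0 : 0 < v := Real.sqrt_pos.2 (by positivity)
  have hv2 : v ^ 2 = θ₀ * lam := Real.sq_sqrt (by positivity)
  set X : Ω → ℝ≥0∞ := fun ω => servingBound L₀ (N.h 0 ω) with hX
  set Y : Ω → ℝ≥0∞ := fun ω => ENNReal.ofReal lam * (N.interference L ω)⁻¹ with hY
  have hI := hN.measurable_interference hL.measurable
  have hg := measurable_servingBound L₀
  have hXm : Measurable X := hg.comp (hN.measurable_fading 0)
  have hYm : Measurable Y := hI.inv.const_mul _
  have hXY : IndepFun X Y P :=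
    (hN.indepFun_mark_interference hL.measurable).comp (φ := fun a : ℝ × S => servingBound L₀ a.1)
      (ψ := fun y => ENNReal.ofReal lam * y⁻¹) (hg.comp measurable_fst)
      (measurable_inv.const_mul _)
  have hYC : ∫⁻ ω, Y ω ^ 2 ∂P ≤ C := by
    refine le_trans (le_of_eq ?_) hC
    rw [← lintegral_const_mul' _ _ ENNReal.ofReal_ne_top]
    refine lintegral_congr fun ω => ?_
    rw [hY]
    simp only
    rw [mul_pow, ENNReal.ofReal_pow hlam.le, ENNReal.inv_pow]
  have hsinr : ∀ ω, ENNReal.ofReal lam * N.sinr L N₀ ω ≤ X ω * Y ω := by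
    intro ω
    have h1 : N.power L 0 ω ≤ X ω := by
      rw [Network.power, ENNReal.ofReal_mul' (hL.nonneg _ _ (norm_nonneg _))]
      exact mul_le_mul_right (ENNReal.ofReal_le_ofReal (hL.le _ _ (norm_nonneg _))) _
    rw [Network.sinr, div_eq_mul_inv, hY]
    simp only
    rw [mul_left_comm (X ω)]
    exact mul_le_mul_right (mul_le_mul' h1 (ENNReal.inv_le_inv.2 le_self_add)) _
  have hpt : ∀ ω, ENNReal.ofReal lam * {ω | ENNReal.ofReal θ₀ ≤ N.sinr L N₀ ω}.indicator
      (fun ω => log2OnePlus (N.sinr L N₀ ω)) ω ≤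
      2 * {ω | ENNReal.ofReal (v ^ 2) ≤ X ω * Y ω}.indicator (fun ω => X ω * Y ω) ω := by
    intro ω
    by_cases h : ENNReal.ofReal θ₀ ≤ N.sinr L N₀ ω
    · have h2 : ENNReal.ofReal (v ^ 2) ≤ X ω * Y ω := by
        refine le_trans ?_ (hsinr ω)
        rw [hv2, mul_comm, ENNReal.ofReal_mul hlam.le]
        exact mul_le_mul_right h _
      have h' : ω ∈ {ω | ENNReal.ofReal θ₀ ≤ N.sinr L N₀ ω} := h
      have h2' : ω ∈ {ω | ENNReal.ofReal (v ^ 2) ≤ X ω * Y ω} := h2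
      rw [indicator_of_mem h', indicator_of_mem h2']
      refine (mul_le_mul_right (log2OnePlus_le _) _).trans ?_
      rw [mul_left_comm]
      exact mul_le_mul_right (hsinr ω) _
    · have h' : ω ∉ {ω | ENNReal.ofReal θ₀ ≤ N.sinr L N₀ ω} := h
      rw [indicator_of_notMem h', mul_zero]
      exact zero_le
  rw [constrainedASE, ← lintegral_const_mul' _ _ ENNReal.ofReal_ne_top]
  refine (lintegral_mono hpt).trans ?_
  rw [lintegral_const_mul' _ _ ENNReal.ofNat_ne_top]
  refine mul_le_mul_right ((lintegral_mul_indicator_le hXm hYm hXY hv0).trans ?_) _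
  have hT := hN.lintegral_fading (φ := {t | ENNReal.ofReal v ≤ servingBound L₀ t}.indicator
    (servingBound L₀)) (hg.indicator (measurableSet_le measurable_const hg))
  have hE := hN.lintegral_fading hg
  rw [← hT, ← hE]
  exact add_le_add (mul_le_mul_right (add_le_add_right hYC _) _)
    (mul_le_mul_right (mul_le_mul_right hYC _) _)

lemma tendsto_constrainedASE_of_negativeMomentSum_lt_top (hH : IsFadingLaw H) {L₀ : ℝ}
    (hL : IsPhysicallyFeasible σ L L₀) (N₀ : ℝ) {θ₀ : ℝ} (hθ₀ : 0 < θ₀) {net : ℝ → Network Ω S}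
    (hnet : ∀ lam, 0 < lam → (net lam).IsPoissonNetwork P H σ lam) {lam₀ : ℝ} (h0 : 0 < lam₀)
    (hfin : negativeMomentSum (H.prod σ) L lam₀ < ∞) :
    Tendsto (fun lam : ℝ => constrainedASE P L N₀ lam θ₀ (net lam)) atTop (𝓝 0) := by
  set C := ENNReal.ofReal (lam₀ ^ 2) * negativeMomentSum (H.prod σ) L lam₀ with hC
  have hCtop : C < ∞ := ENNReal.mul_lt_top ENNReal.ofReal_lt_top hfin
  have hE : ∫⁻ t, servingBound L₀ t ∂H ≠ ∞ := by
    simp_rw [servingBound]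
    rw [lintegral_mul_const' _ _ ENNReal.ofReal_ne_top, hH.mean_one, one_mul]
    exact ENNReal.ofReal_ne_top
  have hv : Tendsto (fun lam : ℝ => √(θ₀ * lam)) atTop atTop :=
    Real.tendsto_sqrt_atTop.comp (tendsto_id.const_mul_atTop hθ₀)
  have hinv : Tendsto (fun lam : ℝ => ENNReal.ofReal (√(θ₀ * lam))⁻¹) atTop (𝓝 0) := by
    simpa using ENNReal.tendsto_ofReal (tendsto_inv_atTop_zero.comp hv)
  have hlim : Tendsto (fun lam : ℝ =>
      2 * ((∫⁻ t, {t | ENNReal.ofReal √(θ₀ * lam) ≤ servingBound L₀ t}.indicator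
          (servingBound L₀) t ∂H) * (1 + C) +
        (∫⁻ t, servingBound L₀ t ∂H) * (ENNReal.ofReal (√(θ₀ * lam))⁻¹ * C))) atTop (𝓝 0) := by
    have h1 := ENNReal.Tendsto.mul_const (b := 1 + C)
      (tendsto_lintegral_indicator_sqrt (measurable_servingBound L₀) hE hθ₀)
      (Or.inr (ENNReal.add_lt_top.2 ⟨ENNReal.one_lt_top, hCtop⟩).ne)
    have h2 := ENNReal.Tendsto.const_mul (a := ∫⁻ t, servingBound L₀ t ∂H)
      (ENNReal.Tendsto.mul_const (b := C) hinv (Or.inr hCtop.ne)) (Or.inr hE)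
    have h3 := ENNReal.Tendsto.const_mul (a := 2) (h1.add h2) (Or.inr ENNReal.ofNat_ne_top)
    simpa using h3
  refine tendsto_of_tendsto_of_tendsto_of_le_of_le' tendsto_const_nhds hlim
    (Eventually.of_forall fun _ => zero_le) ?_
  filter_upwards [eventually_ge_atTop lam₀] with lam hlam
  have hpos : 0 < lam := h0.trans_le hlam
  refine (hnet lam hpos).constrainedASE_le hL N₀ hθ₀ hpos ?_
  calc _ ≤ ENNReal.ofReal (lam ^ 2) *
        (ENNReal.ofReal ((lam₀ / lam) ^ 2) * negativeMomentSum (H.prod σ) L lam₀) :=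
        mul_le_mul_right (((hnet lam hpos).lintegral_inv_sq_interference_le hpos.le
          hL.measurable).trans (negativeMomentSum_le _ L h0 hlam)) _
    _ = C := by
        rw [← mul_assoc, ← ENNReal.ofReal_mul (by positivity), hC]
        congr 2
        field_simp

lemma FiniteSecondNegativeMoment.exists_negativeMomentSum_lt_top
    (hL : Measurable (Function.uncurry L)) {net : ℝ → Network Ω S}
    (hnet : ∀ lam, 0 < lam → (net lam).IsPoissonNetwork P H σ lam)
    (h : FiniteSecondNegativeMoment P L net) :
    ∃ lam, 0 < lam ∧ negativeMomentSum (H.prod σ) L lam < ∞ := by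
  obtain ⟨lamc, h0, h⟩ := h
  -- `lamc` itself may be `0`, while a positive density is needed.
  have hpos : 0 < lamc + 1 := by linarith
  refine ⟨lamc + 1, hpos, ?_⟩
  have h1 := ((hnet _ hpos).le_lintegral_inv_sq_interference hpos.le hL).trans_lt
    (h _ hpos (by linarith))
  refine ENNReal.lt_top_of_mul_ne_top_right h1.ne ?_
  rw [ENNReal.ofReal_ne_zero_iff]
  positivity

end Network

end CellularNetwork

end

theorem theorem2 {Ω S : Type*} [MeasurableSpace Ω] [MeasurableSpace S]
    (P : Measure Ω) [IsProbabilityMeasure P] (σ : Measure S) [IsProbabilityMeasure σ]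
    (H : Measure ℝ) (hH : CellularNetwork.IsFadingLaw H)
    (L : S → ℝ → ℝ) (L₀ : ℝ) (hL : CellularNetwork.IsPhysicallyFeasible σ L L₀)
    (N₀ : ℝ) (hN₀ : 0 ≤ N₀)
    (net : ℝ → CellularNetwork.Network Ω S)
    (hnet : ∀ lam, 0 < lam → (net lam).IsPoissonNetwork P H σ lam)
    (hcond : CellularNetwork.FiniteSecondNegativeMoment P L net ∨
      CellularNetwork.HasTailMinorant L)
    (ε θ₀ : ℝ) (hε : 0 < ε) (hθ₀ : ε ≤ θ₀) :
    Tendsto (fun lam : ℝ => CellularNetwork.constrainedASE P L N₀ lam θ₀ (net lam))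
      atTop (𝓝 0) := by
  have := hH.isProbabilityMeasure
  obtain ⟨lam₀, h0, hfin⟩ := hcond.elim
    (fun h => h.exists_negativeMomentSum_lt_top hL.measurable hnet)
    (fun h => h.exists_negativeMomentSum_lt_top hH (σ := σ))
  exact CellularNetwork.tendsto_constrainedASE_of_negativeMomentSum_lt_top hH hL N₀
    (hε.trans_le hθ₀) hnet h0 hfin
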